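/- Let $L_2=\mathbb Z_2\wr\mathbb Z$ be the lamplighter group: the set of pairs $(\delta,f)$ with $\delta\in\mathbb Z$ and $f:\mathbb Z\to\mathbb Z_2$ finitely supported, with product $(\delta_1,f_1)(\delta_2,f_2)=(\delta_1+\delta_2,\,f_1^{\delta_2}+f_2)$, where $f^{b}(x)=f(x+b)$. It is generated by $a=(0,\mathbf 1_0)$ (where $\mathbf 1_0$ is $1$ at $0$ and $0$ elsewhere) and $t=(1,0)$. For $n\ge 1$ let $\pi_n(f):\mathbb Z/n\to\mathbb Z_2$ be given by $\pi_n(f)(x)=\sum_{y\equiv x \bmod n}f(y)$, and for $\delta\neq 0$ put $\pi_\delta=\pi_{|\delta|}$. **(1)** The conjugacy problem over $L_2$ is decidable in linear time: there are a random-access machine (with additions, subtractions, indirect addressing and conditional jumps, each instruction counted as one step) and a constant $C$ such that, given any two words $u,v$ in the letters $a^{\pm1},t^{\pm1}$, the machine halts after at most $C(|u|+|v|+1)$ steps and correctly answers whether $u$ and $v$ define conjugate elements of $L_2$; moreover its registers never hold numbers larger than $C(|u|+|v|+1)$. **(2)** Conjugacy of $c_1=(\delta_1,f_{c_1})$ and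 $c_2=(\delta_2,f_{c_2})$ is described as follows. - If $c_1$ and $c_2$ are conjugate, then $\delta_1=\delta_2$. - If $\delta_1=\delta_2=0$, then $c_1$ and $c_2$ are conjugate if and only if $f_{c_1}=f_{c_2}^{\Delta}$ for some $\Delta\in\mathbb Z$. - If $\delta_1=\delta_2=\delta\ne0$, let $s_i\in\{0,1\}^{|\delta|}$ be the bit string $\pi_\delta(f_{c_i})(0)\,\pi_\delta(f_{c_i})(1)\cdots\pi_\delta(f_{c_i})(|\delta|-1)$. Then the following are equivalent: $c_1$ and $c_2$ are conjugate; there is $\Delta\in\mathbb Z$ with $\pi_\delta(f_{c_1})(x)=\pi_\delta(f_{c_2})(x+\Delta)$ for all $x\in\mathbb Z/\delta$; $s_1$ is a cyclic rotation of $s_2$; $s_1$ occurs as a contiguous substring of $s_2s_2$. -/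

import Mathlib

/-! ## The lamplighter group -/

/-- Finitely supported functions `G → ℤ/2`: lamp configurations on the abelian group `G`. -/
abbrev Lamps (G : Type) : Type := G →₀ ZMod 2

/-- The shift `f ^ b` of a configuration: `(f ^ b) x = f (x + b)`. -/
noncomputable def lampShift {G : Type} [AddCommGroup G] (f : Lamps G) (b : G) : Lamps G :=
  Finsupp.equivMapDomain (Equiv.subRight b) f

@[simp] theorem lampShift_apply {G : Type} [AddCommGroup G] (f : Lamps G) (b x : G) :
    lampShift f b x = f (x + b) := by
  simp [lampShift, Finsupp.equivMapDomain_apply]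

/-- The lamplighter group `ℤ₂ ≀ ℤ`: pairs `(δ, f)` with `δ` the position of the lamplighter and
`f` the configuration of the lamps. -/
@[ext] structure Lamplighter where
  pos : ℤ
  lamps : Lamps ℤ

namespace Lamplighter

/-- `(δ₁, f₁) (δ₂, f₂) = (δ₁ + δ₂, f₁ ^ δ₂ + f₂)`. -/
noncomputable instance : Mul Lamplighter :=
  ⟨fun g h => ⟨g.pos + h.pos, lampShift g.lamps h.pos + h.lamps⟩⟩

noncomputable instance : One Lamplighter := ⟨⟨0, 0⟩⟩

/-- `(δ, f)⁻¹ = (-δ, - f ^ (-δ))`. -/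
noncomputable instance : Inv Lamplighter :=
  ⟨fun g => ⟨-g.pos, -lampShift g.lamps (-g.pos)⟩⟩

@[simp] theorem mul_pos' (g h : Lamplighter) : (g * h).pos = g.pos + h.pos := rfl

@[simp] theorem mul_lamps (g h : Lamplighter) :
    (g * h).lamps = lampShift g.lamps h.pos + h.lamps := rfl

@[simp] theorem one_pos' : (1 : Lamplighter).pos = 0 := rfl

@[simp] theorem one_lamps : (1 : Lamplighter).lamps = 0 := rfl

@[simp] theorem inv_pos' (g : Lamplighter) : (g⁻¹).pos = -g.pos := rfl

@[simp] theorem inv_lamps (g : Lamplighter) : (g⁻¹).lamps = -lampShift g.lamps (-g.pos) := rfl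

noncomputable instance : Group Lamplighter :=
  Group.ofLeftAxioms
    (fun g h k => by
      ext x
      · simp [add_assoc]
      · simp [add_assoc, add_comm k.pos h.pos])
    (fun g => by
      ext x
      · simp
      · simp)
    (fun g => by
      ext x
      · simp
      · simp [CharTwo.add_self_eq_zero])

/-- The generator `a`: switch the lamp at the origin. -/
noncomputable def genA : Lamplighter := ⟨0, Finsupp.single 0 1⟩

/-- The generator `t`: move the lamplighter by one. -/
noncomputable def genT : Lamplighter := ⟨1, 0⟩

end Lamplighter

/-- The group alphabet `{a, a⁻¹, t, t⁻¹}`. -/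
inductive LampLetter where
  | a
  | aInv
  | t
  | tInv

/-- The group element named by a letter. -/
noncomputable def LampLetter.val : LampLetter → Lamplighter
  | .a => Lamplighter.genA
  | .aInv => Lamplighter.genA⁻¹
  | .t => Lamplighter.genT
  | .tInv => Lamplighter.genT⁻¹

/-- The group element defined by a word. -/
noncomputable def lampWordVal (w : List LampLetter) : Lamplighter :=
  (w.map LampLetter.val).prod

/-- The projection `π_n` onto configurations on `ℤ / n`:
`π_n f x` is the sum of `f y` over all integers `y ≡ x` modulo `n`. -/
noncomputable def lampProj (n : ℕ) (f : Lamps ℤ) : Lamps (ZMod n) :=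
  Finsupp.mapDomain (fun y : ℤ => (y : ZMod n)) f

/-- The bit string `π_n f 0, …, π_n f (n - 1)` of length `n`. -/
noncomputable def lampBits (n : ℕ) (f : Lamps ℤ) : List (ZMod 2) :=
  List.ofFn fun i : Fin n => lampProj n f ((i : ℕ) : ZMod n)

/-! ## Random-access machines -/

namespace RAM

/-- Instructions of a random-access machine. Registers `X 0, X 1, …` hold natural numbers. -/
inductive Instr where
  /-- `X i ← c` -/
  | const (i c : ℕ)
  /-- `X i ← X j + X k` -/
  | add (i j k : ℕ)
  /-- `X i ← max (X j - X k) 0` -/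
  | sub (i j k : ℕ)
  /-- `X i ← X (X j)` -/
  | load (i j : ℕ)
  /-- `X (X i) ← X j` -/
  | store (i j : ℕ)
  /-- `X i ←` the entry of the input with index `X j` (counted from zero), and `X i ← 0` if the
  input has no such entry -/
  | read (i j : ℕ)
  /-- if `X j > 0`, go to instruction number `m` -/
  | jumpPos (j m : ℕ)

/-- A program is a finite list of instructions, numbered from zero. -/
abbrev Program : Type := List Instr

/-- A configuration: the program counter and the contents of the registers. -/
structure Config where
  pc : ℕ
  reg : ℕ → ℕ

/-- The computation starts with the first instruction and all registers equal to zero. -/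
def start : Config := ⟨0, fun _ => 0⟩

/-- Execute one instruction. -/
def Instr.exec (input : List ℕ) (c : Config) : Instr → Config
  | .const i v => ⟨c.pc + 1, Function.update c.reg i v⟩
  | .add i j k => ⟨c.pc + 1, Function.update c.reg i (c.reg j + c.reg k)⟩
  | .sub i j k => ⟨c.pc + 1, Function.update c.reg i (c.reg j - c.reg k)⟩
  | .load i j => ⟨c.pc + 1, Function.update c.reg i (c.reg (c.reg j))⟩
  | .store i j => ⟨c.pc + 1, Function.update c.reg (c.reg i) (c.reg j)⟩
  | .read i j => ⟨c.pc + 1, Function.update c.reg i (input.getD (c.reg j) 0)⟩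
  | .jumpPos j m => ⟨if 0 < c.reg j then m else c.pc + 1, c.reg⟩

/-- One step; nothing changes once the program counter has left the program. -/
def step (P : Program) (input : List ℕ) (c : Config) : Config :=
  match P[c.pc]? with
  | some ins => ins.exec input c
  | none => c

/-- The configuration after `T` steps. -/
def run (P : Program) (input : List ℕ) (T : ℕ) : Config :=
  (step P input)^[T] start

/-- A configuration is halted if its program counter lies outside the program. -/
def Halted (P : Program) (c : Config) : Prop := P.length ≤ c.pc

/-- On the given input the program halts after at most `B` steps, its answer in register `0` is
`1` if `p` holds and `0` if `p` fails, and no register ever holds a number greater than `B`. -/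
def DecidesWithin (P : Program) (input : List ℕ) (p : Prop) (B : ℕ) : Prop :=
  ∃ T ≤ B, Halted P (run P input T) ∧
    (p → (run P input T).reg 0 = 1) ∧ (¬ p → (run P input T).reg 0 = 0) ∧
    ∀ s ≤ T, ∀ i, (run P input s).reg i ≤ B

end RAM

/-- The code of a letter. -/
def LampLetter.code : LampLetter → ℕ
  | .a => 1
  | .aInv => 2
  | .t => 3
  | .tInv => 4

/-- A pair of words as the input of a machine: the letters of the first word, the separator `5`,
the letters of the second word. -/
def lampPairCode (u v : List LampLetter) : List ℕ :=
  u.map LampLetter.code ++ 5 :: v.map LampLetter.code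

/-! Comparing lamps in `g * c₁ = c₂ * g` for g = (γ, k) gives f₁ = f₂^γ + (k + k^δ), where δ is the
common position: conjugacy is equality up to a shift and a coboundary (`lamplighter_isConj_iff`).
For δ = 0 coboundaries vanish in characteristic 2. For δ ≠ 0 they form the kernel of π_δ, because
adding a coboundary can move any lamp by a multiple of δ (`mem_range_lampCoboundary`); what remains
is rotation of the projections to ℤ/δ.

For the machine both cases become one rotation problem. The words produce configurations supported
in [-N, N], and on a cycle longer than 6N rotation of the projections is equivalent to a shift on ℤ
(`exists_lampShift_iff_lampProj`). So the cycle has length M = |δ|, or M = 8N when δ = 0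
(`isConj_iff_cyclic`). Walking along both words modulo M writes the projections into memory.
Rotation is then tested by a two-pointer search for least rotations (`CyclicInv`): a mismatch after
k equal entries discards k + 1 starting points at once, so i + j + k grows by one per comparison and
O(M) comparisons suffice.

The program consists of jump-free blocks, whose effect is computed symbolically, and three loops. A
block of fixed length multiplies a register bound by a constant, and the loop invariants restore the
bound before every pass, so all values stay linear. -/

/-! ### Coboundaries and the conjugacy criterion -/

theorem lampShift_add_left {G : Type} [AddCommGroup G] (f g : Lamps G) (b : G) :
    lampShift (f + g) b = lampShift f b + lampShift g b := by
  ext x; simp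

theorem lampShift_single {G : Type} [AddCommGroup G] (y b : G) (c : ZMod 2) :
    lampShift (Finsupp.single y c) b = Finsupp.single (y - b) c := by
  simp [lampShift, Finsupp.equivMapDomain_single]

@[simp] theorem lampShift_zero_right {G : Type} [AddCommGroup G] (f : Lamps G) :
    lampShift f 0 = f := by
  ext x; simp

theorem lampProj_add (n : ℕ) (f g : Lamps ℤ) :
    lampProj n (f + g) = lampProj n f + lampProj n g :=
  Finsupp.mapDomain_add

theorem lampProj_single (n : ℕ) (y : ℤ) (c : ZMod 2) :
    lampProj n (Finsupp.single y c) = Finsupp.single (y : ZMod n) c :=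
  Finsupp.mapDomain_single

theorem lampProj_lampShift (n : ℕ) (f : Lamps ℤ) (b : ℤ) :
    lampProj n (lampShift f b) = lampShift (lampProj n f) (b : ZMod n) := by
  induction f using Finsupp.induction_linear with
  | zero => ext x; simp [lampProj, show lampShift (0 : Lamps ℤ) b = 0 by ext; simp]
  | add f g hf hg => simp only [lampShift_add_left, lampProj_add, hf, hg]
  | single y c => simp [lampShift_single, lampProj_single]

/-- The map `k ↦ k + k ^ δ`, whose range is the set of coboundaries. -/
noncomputable def lampCoboundary (δ : ℤ) : Lamps ℤ →+ Lamps ℤ where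
  toFun k := k + lampShift k δ
  map_zero' := by ext x; simp
  map_add' f g := by ext x; simp; ring

theorem lampCoboundary_apply (δ : ℤ) (k : Lamps ℤ) :
    lampCoboundary δ k = k + lampShift k δ := rfl

theorem lamps_add_self {G : Type} (f : Lamps G) : f + f = 0 := by
  ext x; simp [CharTwo.add_self_eq_zero]

theorem lamps_sub_eq_add {G : Type} (f g : Lamps G) : f - g = f + g := by
  ext x; simp [CharTwo.sub_eq_add]

/-- The coboundary of one lamp at z + δ is the sum of the lamps at z + δ and z; these steps
telescope along multiples of δ. -/
theorem single_sub_single_mem_range (δ y m : ℤ) (c : ZMod 2) :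
    Finsupp.single (y + δ * m) c - Finsupp.single y c ∈ (lampCoboundary δ).range := by
  have base : ∀ z, Finsupp.single (z + δ) c - Finsupp.single z c ∈ (lampCoboundary δ).range := by
    intro z
    refine ⟨Finsupp.single (z + δ) c, ?_⟩
    rw [lampCoboundary_apply, lampShift_single, lamps_sub_eq_add]
    simp
  induction m using Int.induction_on with
  | zero => simp
  | succ i ih =>
    have := add_mem ih (base (y + δ * i))
    rw [show y + δ * ((i : ℤ) + 1) = y + δ * i + δ by ring]
    convert this using 1
    abel
  | pred i ih =>
    have := sub_mem ih (base (y + δ * (-i - 1)))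
    rw [show y + δ * (-(i : ℤ) - 1) + δ = y + δ * (-i) by ring] at this
    convert this using 1
    abel

/-- Modulo coboundaries every lamp can be moved to its residue in [0, |δ|), so f is cohomologous to
a configuration determined by its projection. By linearity a single lamp suffices, and a zero
projection leaves only a coboundary. -/
theorem mem_range_lampCoboundary {δ : ℤ} {h : Lamps ℤ} (hδ : δ ≠ 0)
    (hh : lampProj δ.natAbs h = 0) : h ∈ (lampCoboundary δ).range := by
  have : NeZero δ.natAbs := ⟨by simpa using hδ⟩
  let rep : ZMod δ.natAbs → ℤ := fun x => (x.val : ℤ)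
  have key : ∀ f : Lamps ℤ,
      f - (lampProj δ.natAbs f).mapDomain rep ∈ (lampCoboundary δ).range := by
    intro f
    induction f using Finsupp.induction_linear with
    | zero => simp [lampProj]
    | add f g hf hg =>
      rw [lampProj_add, Finsupp.mapDomain_add]
      convert add_mem hf hg using 1
      abel
    | single y c =>
      rw [lampProj_single, Finsupp.mapDomain_single]
      have hrep : rep (y : ZMod δ.natAbs) = y % δ := by
        simp only [rep, ZMod.val_intCast]
        simp
      rw [hrep]
      have := single_sub_single_mem_range δ (y % δ) (y / δ) c
      rwa [Int.emod_add_mul_ediv] at this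
  simpa [hh] using key h

/-- The pair (γ, k) is the conjugator itself; signs disappear because every configuration is its own
negative. -/
theorem lamplighter_isConj_iff (c₁ c₂ : Lamplighter) :
    IsConj c₁ c₂ ↔ c₁.pos = c₂.pos ∧ ∃ (γ : ℤ) (k : Lamps ℤ),
      c₁.lamps = lampShift c₂.lamps γ + lampCoboundary c₁.pos k := by
  rw [isConj_iff]
  constructor
  · rintro ⟨g, hg⟩
    rw [mul_inv_eq_iff_eq_mul, Lamplighter.ext_iff] at hg
    simp only [Lamplighter.mul_pos', Lamplighter.mul_lamps] at hg
    refine ⟨by linarith [hg.1], g.pos, g.lamps, ?_⟩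
    rw [lampCoboundary_apply, ← add_assoc, ← hg.2, add_right_comm, lamps_add_self, zero_add]
  · rintro ⟨h1, γ, k, h2⟩
    refine ⟨⟨γ, k⟩, ?_⟩
    rw [mul_inv_eq_iff_eq_mul, Lamplighter.ext_iff]
    simp only [Lamplighter.mul_pos', Lamplighter.mul_lamps]
    refine ⟨by linarith, ?_⟩
    rw [h2, lampCoboundary_apply]
    ext x
    simp only [Finsupp.add_apply]
    have := CharTwo.add_self_eq_zero (lampShift k c₁.pos x)
    linear_combination this

theorem isConj_iff_of_pos_eq_zero {c₁ c₂ : Lamplighter} (h₁ : c₁.pos = 0) (h₂ : c₂.pos = 0) :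
    IsConj c₁ c₂ ↔ ∃ Δ : ℤ, c₁.lamps = lampShift c₂.lamps Δ := by
  have hz : ∀ k, lampCoboundary 0 k = 0 := fun k => by
    rw [lampCoboundary_apply, lampShift_zero_right, lamps_add_self]
  rw [lamplighter_isConj_iff]
  simp [h₁, h₂, hz]

theorem isConj_iff_lampProj {δ : ℤ} {c₁ c₂ : Lamplighter} (hδ : δ ≠ 0) (h₁ : c₁.pos = δ)
    (h₂ : c₂.pos = δ) :
    IsConj c₁ c₂ ↔ ∃ Δ : ℤ, lampProj δ.natAbs c₁.lamps =
      lampShift (lampProj δ.natAbs c₂.lamps) (Δ : ZMod δ.natAbs) := by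
  rw [lamplighter_isConj_iff, h₁, h₂]
  have hδ0 : ((δ : ℤ) : ZMod δ.natAbs) = 0 := by
    rw [ZMod.intCast_zmod_eq_zero_iff_dvd]; simp
  constructor
  · rintro ⟨-, γ, k, h⟩
    refine ⟨γ, ?_⟩
    rw [h, lampCoboundary_apply, lampProj_add, lampProj_add, lampProj_lampShift,
      lampProj_lampShift, hδ0, lampShift_zero_right, lamps_add_self, add_zero]
  · rintro ⟨Δ, h⟩
    obtain ⟨k, hk⟩ := mem_range_lampCoboundary (δ := δ)
      (h := lampShift c₂.lamps Δ + c₁.lamps) hδ (by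
        rw [lampProj_add, lampProj_lampShift, h, lamps_add_self])
    exact ⟨rfl, Δ, k, by rw [hk, ← add_assoc, lamps_add_self, zero_add]⟩

/-! ### Rotations of bit strings -/

/-- The window of length |l₂| at offset n ≤ |l₂| in l₂l₂ is the rotation of l₂ by n, and equal
lengths force every occurrence of l₁ to be such a window. -/
theorem isRotated_iff_infix {α : Type*} {l₁ l₂ : List α} (h : l₁.length = l₂.length) :
    l₁ ~r l₂ ↔ l₁ <:+: l₂ ++ l₂ := by
  constructor
  · intro hr
    obtain ⟨n, hn, rfl⟩ := List.isRotated_iff_mod.1 hr.symm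
    rw [List.rotate_eq_drop_append_take hn]
    refine ⟨l₂.take n, l₂.drop n, ?_⟩
    rw [← List.append_assoc, List.take_append_drop, List.append_assoc, List.take_append_drop]
  · rintro ⟨s, t, hst⟩
    have hs : s.length ≤ l₂.length := by
      have := congrArg List.length hst
      simp at this; omega
    have h1 : l₁ = ((l₂ ++ l₂).drop s.length).take l₂.length := by
      rw [← hst, List.append_assoc, List.drop_left, ← h, List.take_left]
    refine List.IsRotated.symm ⟨s.length, ?_⟩
    have h2 := List.take_length_add_append (l₁ := l₂.drop s.length) (l₂ := l₂) s.length
    rw [List.length_drop, Nat.sub_add_cancel hs] at h2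
    rw [List.rotate_eq_drop_append_take hs, h1, List.drop_append_of_le_length hs, h2]

theorem lampBits_isRotated_iff {n : ℕ} [NeZero n] (f₁ f₂ : Lamps ℤ) :
    lampBits n f₁ ~r lampBits n f₂ ↔
      ∃ Δ : ℤ, lampProj n f₁ = lampShift (lampProj n f₂) (Δ : ZMod n) := by
  have hn : 0 < n := Nat.pos_of_neZero n
  constructor
  · intro h
    obtain ⟨m, hm⟩ := h.symm
    refine ⟨m, ?_⟩
    ext x
    have hx := x.val_lt
    have := congrArg (fun l => l[x.val]?) hm
    simp only [lampBits] at this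
    rw [List.getElem?_eq_getElem (by simpa using hx), List.getElem?_eq_getElem (by simpa using hx),
      List.getElem_rotate] at this
    simp at this
    simpa using this.symm
  · rintro ⟨Δ, h⟩
    refine List.IsRotated.symm ⟨(Δ : ZMod n).val, ?_⟩
    apply List.ext_getElem
    · simp [lampBits]
    · intro i h1 h2
      rw [List.getElem_rotate]
      simp [lampBits, h]

theorem lamplighter_conj_tfae {δ : ℤ} {c₁ c₂ : Lamplighter} (hδ : δ ≠ 0) (h₁ : c₁.pos = δ)
    (h₂ : c₂.pos = δ) :
    List.TFAE [
        IsConj c₁ c₂,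
        ∃ Δ : ℤ, lampProj δ.natAbs c₁.lamps =
          lampShift (lampProj δ.natAbs c₂.lamps) (Δ : ZMod δ.natAbs),
        List.IsRotated (lampBits δ.natAbs c₁.lamps) (lampBits δ.natAbs c₂.lamps),
        lampBits δ.natAbs c₁.lamps <:+:
          lampBits δ.natAbs c₂.lamps ++ lampBits δ.natAbs c₂.lamps] := by
  have : NeZero δ.natAbs := ⟨by simpa using hδ⟩
  tfae_have 1 ↔ 2 := isConj_iff_lampProj hδ h₁ h₂
  tfae_have 3 ↔ 2 := lampBits_isRotated_iff _ _
  tfae_have 3 ↔ 4 := isRotated_iff_infix (by simp [lampBits])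
  tfae_finish

/-! ### Position zero on a sufficiently long cycle -/

theorem lampProj_apply_eq_zero {n : ℕ} {f : Lamps ℤ} {x : ZMod n}
    (h : ∀ y : ℤ, (y : ZMod n) = x → f y = 0) : lampProj n f x = 0 := by
  by_contra hx
  have hx' : x ∈ (lampProj n f).support := by simpa using hx
  obtain ⟨y, hy, rfl⟩ := Finset.mem_image.1 (Finsupp.mapDomain_support hx')
  exact (Finsupp.mem_support_iff.1 hy) (h y rfl)

/-- On an interval of length less than `n` that contains the support of `f`, the projection
`π_n f` agrees with `f`. -/
theorem lampProj_intCast {n : ℕ} {f : Lamps ℤ} {K : ℤ} (hn : 2 * K < n)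
    (hf : ∀ y, f y ≠ 0 → |y| ≤ K) {x : ℤ} (hx : |x| ≤ K) :
    lampProj n f (x : ZMod n) = f x := by
  have hsplit : f = Finsupp.single x (f x) + f.erase x := (Finsupp.single_add_erase x f).symm
  rw [hsplit, lampProj_add, lampProj_single, ← hsplit, Finsupp.add_apply, Finsupp.single_eq_same,
    lampProj_apply_eq_zero, add_zero]
  intro y hy
  by_contra hne
  have hyx : y ≠ x := by
    rintro rfl
    simp at hne
  rw [Finsupp.erase_ne hyx] at hne
  have hyK := hf y hne
  rw [ZMod.intCast_eq_intCast_iff_dvd_sub] at hy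
  obtain ⟨m, hm⟩ := hy
  rw [abs_le] at hx hyK
  rcases lt_trichotomy m 0 with h | h | h
  · nlinarith
  · subst h; apply hyx; linarith
  · nlinarith

/-- A rotation is known only modulo n. Matching one lit lamp x of f₁ with a lit lamp y of f₂ lifts
it to the integer y - x, of size at most 2K. The shifted f₂ is then supported in [-3K, 3K], where 6K
< n makes the projection faithful. -/
theorem exists_lampShift_iff_lampProj {n : ℕ} {f₁ f₂ : Lamps ℤ} {K : ℤ} (hn : 6 * K < n)
    (h₁ : ∀ y, f₁ y ≠ 0 → |y| ≤ K) (h₂ : ∀ y, f₂ y ≠ 0 → |y| ≤ K) :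
    (∃ Δ : ℤ, f₁ = lampShift f₂ Δ) ↔
      ∃ Δ : ℤ, lampProj n f₁ = lampShift (lampProj n f₂) (Δ : ZMod n) := by
  constructor
  · rintro ⟨Δ, rfl⟩
    exact ⟨Δ, lampProj_lampShift _ _ _⟩
  · rintro ⟨Δ, h⟩
    have h2K : ∀ {f : Lamps ℤ}, (∀ y, f y ≠ 0 → |y| ≤ K) → ∀ {y}, f y ≠ 0 →
        lampProj n f y = f y := fun {f} hf {y} hy =>
      lampProj_intCast (by have := (abs_nonneg y).trans (hf y hy); linarith) hf (hf y hy)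
    -- Without a lit lamp to match, f₂ must vanish too: a lit lamp of f₂ would survive in its
    -- projection.
    by_cases hz : f₁ = 0
    · refine ⟨0, ?_⟩
      rw [lampShift_zero_right, hz]
      symm
      ext y
      by_contra hy
      have h3 := DFunLike.congr_fun h ((y : ZMod n) - Δ)
      rw [lampShift_apply, sub_add_cancel, h2K h₂ hy, hz] at h3
      simp [lampProj] at h3
      exact hy h3.symm
    · obtain ⟨x, hx⟩ := Finsupp.ne_iff.1 hz
      simp only [Finsupp.coe_zero, Pi.zero_apply] at hx
      have h3 := DFunLike.congr_fun h (x : ZMod n)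
      rw [lampShift_apply, h2K h₁ hx] at h3
      obtain ⟨y, hy, hy0⟩ : ∃ y : ℤ, (y : ZMod n) = x + Δ ∧ f₂ y ≠ 0 := by
        by_contra hcon
        push Not at hcon
        exact hx (h3.trans (lampProj_apply_eq_zero hcon))
      refine ⟨y - x, ?_⟩
      have hΔ : ((y - x : ℤ) : ZMod n) = Δ := by push_cast; rw [hy]; ring
      rw [← hΔ, ← lampProj_lampShift] at h
      have hxK := h₁ x hx
      have hyK := h₂ y hy0
      have hK : 0 ≤ K := (abs_nonneg x).trans hxK
      have hg : ∀ z, lampShift f₂ (y - x) z ≠ 0 → |z| ≤ 3 * K := by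
        intro z hz'
        have := h₂ _ (by simpa using hz')
        rw [abs_le] at *
        constructor <;> linarith
      have hf : ∀ z, f₁ z ≠ 0 → |z| ≤ 3 * K := fun z hz' => (h₁ z hz').trans (by linarith)
      ext z
      by_cases hzK : |z| ≤ 3 * K
      · rw [← lampProj_intCast (n := n) (by linarith) hf hzK, h,
          lampProj_intCast (by linarith) hg hzK]
      · rw [not_imp_comm.1 (hf z) hzK, not_imp_comm.1 (hg z) hzK]

/-- The length of the cyclic configurations that the decision procedure compares. -/
def cyclicLength (δ : ℤ) (N : ℕ) : ℕ := if δ = 0 then 8 * N else δ.natAbs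

/-- This is the form that the machine decides: one rotation problem for every δ. Positivity of N
gives 6N < 8N. -/
theorem isConj_iff_cyclic {c₁ c₂ : Lamplighter} {N : ℕ} (hN : 0 < N)
    (h₁ : ∀ y, c₁.lamps y ≠ 0 → |y| ≤ N) (h₂ : ∀ y, c₂.lamps y ≠ 0 → |y| ≤ N) :
    IsConj c₁ c₂ ↔ c₁.pos = c₂.pos ∧ ∃ Δ : ℤ, lampProj (cyclicLength c₁.pos N) c₁.lamps =
      lampShift (lampProj (cyclicLength c₁.pos N) c₂.lamps)
        (Δ : ZMod (cyclicLength c₁.pos N)) := by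
  by_cases hp : c₁.pos = c₂.pos
  · by_cases h0 : c₁.pos = 0
    · rw [isConj_iff_of_pos_eq_zero h0 (hp ▸ h0), exists_lampShift_iff_lampProj
        (n := 8 * N) (by push_cast; linarith [show (0 : ℤ) < N by exact_mod_cast hN]) h₁ h₂,
        show cyclicLength c₁.pos N = 8 * N from if_pos h0]
      simp [hp]
    · rw [isConj_iff_lampProj h0 rfl hp.symm, show cyclicLength c₁.pos N = _ from if_neg h0]
      simp [hp]
  · rw [lamplighter_isConj_iff]
    simp [hp]

@[simp] theorem lampWordVal_nil : lampWordVal [] = 1 := rfl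

@[simp] theorem lampWordVal_concat (w : List LampLetter) (l : LampLetter) :
    lampWordVal (w ++ [l]) = lampWordVal w * l.val := by
  simp [lampWordVal]

theorem lampWordVal_support (w : List LampLetter) :
    ∀ y, (lampWordVal w).lamps y ≠ 0 → |y| ≤ w.length := by
  induction w using List.reverseRecOn with
  | nil => simp
  | append_singleton w l ih =>
    intro y hy
    rw [lampWordVal_concat, Lamplighter.mul_lamps, Finsupp.add_apply, lampShift_apply] at hy
    have h1 : |l.val.pos| ≤ 1 := by
      cases l <;> simp [LampLetter.val, Lamplighter.genA, Lamplighter.genT]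
    have h2 : y ≠ 0 → l.val.lamps y = 0 := by
      intro h
      cases l <;> simp [LampLetter.val, Lamplighter.genA, Lamplighter.genT, h]
    rw [List.length_append, List.length_singleton]
    push_cast
    by_cases h0 : y = 0
    · subst h0; simp; positivity
    · rw [h2 h0, add_zero] at hy
      have := ih _ hy
      rw [abs_le] at *
      constructor <;> linarith

/-! ### Jump-free blocks and loops of a random-access machine -/

namespace RAM

/-- The effect of an instruction on the registers. -/
def Instr.effect (input : List ℕ) (r : ℕ → ℕ) (ins : Instr) : ℕ → ℕ :=
  (ins.exec input ⟨0, r⟩).reg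

/-- The effect of a block of instructions, executed one after the other. -/
def evalBlock (input : List ℕ) (blk : List Instr) (r : ℕ → ℕ) : ℕ → ℕ :=
  blk.foldl (Instr.effect input) r

/-- The instruction is not a jump, and its constant, if it has one, is at most `K`. -/
def Instr.Straight (K : ℕ) : Instr → Prop
  | .const _ c => c ≤ K
  | .jumpPos _ _ => False
  | _ => True

theorem Instr.exec_of_straight {K : ℕ} {ins : Instr} (h : ins.Straight K) (input : List ℕ)
    (c : Config) : ins.exec input c = ⟨c.pc + 1, ins.effect input c.reg⟩ := by
  cases ins <;> first | rfl | exact h.elim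

/-- No straight instruction more than doubles a bound on the registers. -/
theorem Instr.effect_le {K b : ℕ} {ins : Instr} (h : ins.Straight K) (hK : K ≤ b)
    {input : List ℕ} (hin : ∀ x ∈ input, x ≤ b) {r : ℕ → ℕ} (hr : ∀ i, r i ≤ b) (i : ℕ) :
    ins.effect input r i ≤ 2 * b := by
  have hr' : ∀ j, r j ≤ 2 * b := fun j => (hr j).trans (by omega)
  cases ins with
  | const j c =>
    have h : c ≤ K := h
    simp only [effect, exec, Function.update_apply]
    split_ifs
    · omega
    · exact hr' i
  | add j k l =>
    simp only [effect, exec, Function.update_apply]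
    split_ifs
    · have := hr k; have := hr l; omega
    · exact hr' i
  | sub j k l =>
    simp only [effect, exec, Function.update_apply]
    split_ifs
    · have := hr k; omega
    · exact hr' i
  | load j k =>
    simp only [effect, exec, Function.update_apply]
    split_ifs <;> exact hr' _
  | store j k =>
    simp only [effect, exec, Function.update_apply]
    split_ifs <;> exact hr' _
  | read j k =>
    simp only [effect, exec, Function.update_apply]
    split_ifs
    · rw [List.getD_eq_getElem?_getD]
      rcases lt_or_ge (r k) input.length with hlt | hge
      · rw [List.getElem?_eq_getElem hlt]
        exact (hin _ (List.getElem_mem hlt)).trans (by omega)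
      · rw [List.getElem?_eq_none hge]
        simp
    · exact hr' i
  | jumpPos j m => exact h.elim

/-- The machine gets from `c` to `c'` in `t` steps, and on the way no register exceeds `B`. -/
def Reaches (P : Program) (input : List ℕ) (B : ℕ) (c : Config) (t : ℕ) (c' : Config) : Prop :=
  (step P input)^[t] c = c' ∧ ∀ s ≤ t, ∀ i, ((step P input)^[s] c).reg i ≤ B

namespace Reaches

variable {P : Program} {input : List ℕ} {B B' t t' : ℕ} {c c' c'' : Config}

theorem refl (h : ∀ i, c.reg i ≤ B) : Reaches P input B c 0 c :=
  ⟨rfl, fun s hs i => by obtain rfl := Nat.le_zero.1 hs; exact h i⟩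

theorem trans (h : Reaches P input B c t c') (h' : Reaches P input B c' t' c'') :
    Reaches P input B c (t + t') c'' := by
  refine ⟨by rw [add_comm, Function.iterate_add_apply, h.1, h'.1], fun s hs i => ?_⟩
  rcases le_total s t with hst | hst
  · exact h.2 s hst i
  · obtain ⟨p, rfl⟩ := Nat.exists_eq_add_of_le hst
    rw [add_comm, Function.iterate_add_apply, h.1]
    exact h'.2 p (by omega) i

theorem mono (h : Reaches P input B c t c') (hB : B ≤ B') : Reaches P input B' c t c' :=
  ⟨h.1, fun s hs i => (h.2 s hs i).trans hB⟩

theorem single (h : step P input c = c') (hc : ∀ i, c.reg i ≤ B) (hc' : ∀ i, c'.reg i ≤ B) :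
    Reaches P input B c 1 c' := by
  refine ⟨h, fun s hs i => ?_⟩
  interval_cases s
  · exact hc i
  · rw [Function.iterate_one, h]
    exact hc' i

end Reaches

/-- The program `P` contains the block `blk` from the instruction number `o` on. -/
def CodeAt (P : Program) (o : ℕ) (blk : List Instr) : Prop := blk <+: P.drop o

variable {P : Program} {input : List ℕ} {K b o : ℕ} {blk : List Instr}

theorem CodeAt.getElem? {ins : Instr} (h : CodeAt P o (ins :: blk)) : P[o]? = some ins := by
  obtain ⟨t, ht⟩ := h
  have := congrArg (fun l => l[0]?) ht
  simpa using this.symm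

theorem CodeAt.tail {ins : Instr} (h : CodeAt P o (ins :: blk)) : CodeAt P (o + 1) blk := by
  obtain ⟨t, ht⟩ := h
  refine ⟨t, ?_⟩
  have := congrArg List.tail ht
  simpa using this

theorem CodeAt.left {blk' : List Instr} (h : CodeAt P o (blk ++ blk')) : CodeAt P o blk :=
  (List.prefix_append _ _).trans h

theorem CodeAt.right {blk' : List Instr} (h : CodeAt P o (blk ++ blk')) :
    CodeAt P (o + blk.length) blk' := by
  induction blk generalizing o with
  | nil => exact h
  | cons ins blk ih =>
    have := ih (CodeAt.tail (o := o) h)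
    rwa [List.length_cons, add_comm _ 1, ← add_assoc]

/-- Each instruction at most doubles the register bound, so a block costs a factor that depends on
its length only. -/
theorem reaches_block (hP : CodeAt P o blk) (hs : ∀ ins ∈ blk, ins.Straight K) (hK : K ≤ b)
    (hin : ∀ x ∈ input, x ≤ b) {r : ℕ → ℕ} (hr : ∀ i, r i ≤ b) :
    Reaches P input (2 ^ blk.length * b) ⟨o, r⟩ blk.length
      ⟨o + blk.length, evalBlock input blk r⟩ := by
  induction blk generalizing o r b with
  | nil => exact Reaches.refl (by simpa using hr)
  | cons ins blk ih =>
    have hins := hs ins (by simp)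
    have hle : ∀ i, ins.effect input r i ≤ 2 * b := Instr.effect_le hins hK hin hr
    have hb : 2 * b ≤ 2 ^ (ins :: blk).length * b := by
      rw [List.length_cons, pow_succ]
      gcongr
      have := Nat.one_le_two_pow (n := blk.length)
      omega
    have h1 : Reaches P input (2 ^ (ins :: blk).length * b) ⟨o, r⟩ 1
        ⟨o + 1, ins.effect input r⟩ := by
      refine Reaches.single ?_ (fun i => (hr i).trans (by omega)) (fun i => (hle i).trans hb)
      simp [step, hP.getElem?, Instr.exec_of_straight hins]
    have h2 := ih (b := 2 * b) hP.tail (fun i hi => hs i (by simp [hi])) (by omega)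
      (fun x hx => (hin x hx).trans (by omega)) hle
    have h3 := h1.trans (h2.mono (by rw [List.length_cons, pow_succ]; apply le_of_eq; ring))
    rwa [show 1 + blk.length = (ins :: blk).length by simp [add_comm],
      show o + 1 + blk.length = o + (ins :: blk).length by simp; ring] at h3

/-- The loop that repeats `blk` while register `j` is positive. -/
theorem reaches_loop {j : ℕ} (hP : CodeAt P o (blk ++ [.jumpPos j o]))
    (hs : ∀ ins ∈ blk, ins.Straight K) (hK : K ≤ b) (hin : ∀ x ∈ input, x ≤ b)
    {Inv : ℕ → (ℕ → ℕ) → Prop} {Post : (ℕ → ℕ) → Prop}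
    (hInv : ∀ n r, Inv n r → ∀ i, r i ≤ b)
    (hstep : ∀ n r, Inv n r →
      (evalBlock input blk r j = 0 ∧ Post (evalBlock input blk r)) ∨
      (0 < evalBlock input blk r j ∧ ∃ n' < n, Inv n' (evalBlock input blk r)))
    (n : ℕ) (r : ℕ → ℕ) (h : Inv n r) :
    ∃ t ≤ (n + 1) * (blk.length + 1), ∃ r', Post r' ∧
      Reaches P input (2 ^ blk.length * b) ⟨o, r⟩ t ⟨o + (blk.length + 1), r'⟩ := by
  induction n using Nat.strong_induction_on generalizing r with
  | _ n ih =>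
    -- The invariant supplies the bound b anew before every pass, so the factor `2 ^ blk.length`
    -- does not accumulate.
    have h1 := reaches_block hP.left hs hK hin (hInv n r h)
    have hr1 : ∀ i, evalBlock input blk r i ≤ 2 ^ blk.length * b := fun i => by
      have := h1.2 _ le_rfl i
      rwa [h1.1] at this
    have hget := hP.right.getElem?
    rcases hstep n r h with ⟨h0, hpost⟩ | ⟨hpos, n', hn', hinv⟩
    · refine ⟨blk.length + 1, Nat.le_mul_of_pos_left _ (by omega), _, hpost, h1.trans ?_⟩
      refine Reaches.single ?_ hr1 hr1
      simp [step, hget, Instr.exec, h0, add_assoc]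
    · obtain ⟨t, ht, r', hr', hreach⟩ := ih n' hn' _ hinv
      refine ⟨blk.length + 1 + t, ?_, r', hr', (h1.trans ?_).trans hreach⟩
      · calc blk.length + 1 + t ≤ blk.length + 1 + (n' + 1) * (blk.length + 1) := by omega
          _ = (n' + 1 + 1) * (blk.length + 1) := by ring
          _ ≤ _ := by gcongr; omega
      · refine Reaches.single ?_ hr1 hr1
        simp [step, hget, Instr.exec, hpos]

/-- A loop that reads the input letter by letter into register `j` and stops after the end of the
input: it computes a fold over the input. -/
theorem reaches_inputLoop {j : ℕ} (hP : CodeAt P o (blk ++ [.jumpPos j o]))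
    (hs : ∀ ins ∈ blk, ins.Straight K) (hK : K ≤ b) (hin : ∀ x ∈ input, x ≤ b)
    (hpos : ∀ x ∈ input, 0 < x) {σ : Type*} {g : σ → ℕ → σ} {s₀ : σ}
    {R : ℕ → σ → (ℕ → ℕ) → Prop}
    (hR : ∀ q s r, q ≤ input.length → R q s r → ∀ i, r i ≤ b)
    (hstep : ∀ q r, q ≤ input.length → R q ((input.take q).foldl g s₀) r →
      evalBlock input blk r j = input.getD q 0 ∧
      R (q + 1) (g ((input.take q).foldl g s₀) (input.getD q 0)) (evalBlock input blk r))
    {r : ℕ → ℕ} (h : R 0 s₀ r) :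
    ∃ t ≤ (input.length + 1) * (blk.length + 1), ∃ r',
      R (input.length + 1) (g (input.foldl g s₀) 0) r' ∧
      Reaches P input (2 ^ blk.length * b) ⟨o, r⟩ t ⟨o + (blk.length + 1), r'⟩ := by
  refine reaches_loop (Inv := fun n r => ∃ q, n + q = input.length ∧
    R q ((input.take q).foldl g s₀) r) hP hs hK hin ?_ ?_ input.length r ⟨0, rfl, by simpa using h⟩
  · rintro n r ⟨q, hq, hRq⟩
    exact hR _ _ _ (by omega) hRq
  · rintro n r ⟨q, hq, hRq⟩
    obtain ⟨h1, h2⟩ := hstep q r (by omega) hRq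
    rcases Nat.eq_zero_or_pos n with rfl | hn
    -- Past the end the machine reads the default 0, which no letter has as its code. The loop
    -- stops, but only after this 0 has been folded in as well.
    · obtain rfl : q = input.length := by omega
      rw [List.getD_eq_default _ _ le_rfl] at h1 h2
      exact Or.inl ⟨h1, by simpa using h2⟩
    · have hlt : q < input.length := by omega
      rw [List.getD_eq_getElem _ _ hlt] at h1 h2
      refine Or.inr ⟨by rw [h1]; exact hpos _ (List.getElem_mem hlt), n - 1, by omega, q + 1,
        by omega, ?_⟩
      rwa [List.take_add_one, List.getElem?_eq_getElem hlt, Option.toList_some, List.foldl_concat]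

/-- The register contents with the entries of `l` at the beginning, and `m` afterwards. -/
def file (l : List ℕ) (m : ℕ → ℕ) : ℕ → ℕ := fun i => l[i]?.getD (m i)

theorem file_of_lt {l : List ℕ} {m : ℕ → ℕ} {i : ℕ} (h : i < l.length) : file l m i = l[i] := by
  simp [file, h]

theorem file_of_le {l : List ℕ} {m : ℕ → ℕ} {i : ℕ} (h : l.length ≤ i) : file l m i = m i := by
  simp [file, h]

theorem update_file_of_lt {l : List ℕ} {m : ℕ → ℕ} {i v : ℕ} (h : i < l.length) :
    Function.update (file l m) i v = file (l.set i v) m := by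
  funext k
  rcases eq_or_ne k i with rfl | hk
  · simp [file, h]
  · simp [file, hk, List.getElem?_set_ne hk.symm]

theorem update_file_of_le {l : List ℕ} {m : ℕ → ℕ} {i v : ℕ} (h : l.length ≤ i) :
    Function.update (file l m) i v = file l (Function.update m i v) := by
  funext k
  rcases eq_or_ne k i with rfl | hk
  · simp [file, h]
  · simp [file, hk]

theorem file_le {l : List ℕ} {m : ℕ → ℕ} (hl : ∀ x ∈ l, x ≤ b) (hm : ∀ i, m i ≤ b) (i : ℕ) :
    file l m i ≤ b := by
  rcases lt_or_ge i l.length with h | h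
  · rw [file_of_lt h]
    exact hl _ (List.getElem_mem h)
  · rw [file_of_le h]
    exact hm i

end RAM

/-! ### Two-pointer comparison of periodic sequences -/

/-- The sequence `a i, a (i + 1), …` in the lexicographic order. -/
def seqFrom (a : ℕ → ℕ) (i : ℕ) : Lex (ℕ → ℕ) := toLex fun l => a (i + l)

/-- The invariant of the comparison of two periodic sequences `a` and `b`: the starting points
of `a` below `i` and of `b` below `j` are not those of a least shift, and the shifts by `i` and `j`
agree on the first `k` entries. -/
structure CyclicInv (a b : ℕ → ℕ) (i j k : ℕ) : Prop where
  left : ∀ i' < i, ∃ j', seqFrom b j' < seqFrom a i'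
  right : ∀ j' < j, ∃ i', seqFrom a i' < seqFrom b j'
  agree : ∀ l < k, a (i + l) = b (j + l)

namespace CyclicInv

variable {a b : ℕ → ℕ} {i j k M : ℕ}

theorem zero (a b : ℕ → ℕ) : CyclicInv a b 0 0 0 := ⟨by simp, by simp, by simp⟩

theorem symm (h : CyclicInv a b i j k) : CyclicInv b a j i k :=
  ⟨h.right, h.left, fun l hl => (h.agree l hl).symm⟩

theorem step_eq (h : CyclicInv a b i j k) (hk : a (i + k) = b (j + k)) :
    CyclicInv a b i j (k + 1) := by
  refine ⟨h.left, h.right, fun l hl => ?_⟩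
  rcases Nat.lt_succ_iff_lt_or_eq.1 hl with hl | rfl
  · exact h.agree l hl
  · exact hk

/-- For each p ≤ k the shifts of a by i + p and of b by j + p agree for k - p entries, and then b is
smaller. So all of i, …, i + k are discarded together. -/
theorem step_gt (h : CyclicInv a b i j k) (hk : b (j + k) < a (i + k)) :
    CyclicInv a b (i + (k + 1)) j 0 := by
  refine ⟨fun i' hi' => ?_, h.right, by simp⟩
  rcases lt_or_ge i' i with hlt | hge
  · exact h.left i' hlt
  · obtain ⟨p, rfl⟩ := Nat.exists_eq_add_of_le hge
    refine ⟨j + p, k - p, fun l hl => ?_, ?_⟩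
    · change b (j + p + l) = a (i + p + l)
      rw [add_assoc, add_assoc]
      exact (h.agree (p + l) (by omega)).symm
    · change b (j + p + (k - p)) < a (i + p + (k - p))
      rwa [add_assoc, add_assoc, Nat.add_sub_cancel' (by omega)]

theorem step_lt (h : CyclicInv a b i j k) (hk : a (i + k) < b (j + k)) :
    CyclicInv a b i (j + (k + 1)) 0 :=
  (h.symm.step_gt hk).symm

/-- Agreement on a full period is agreement everywhere. The shift is j - i modulo M, with (M - 1) *
i standing for -i to stay in ℕ. -/
theorem exists_shift (h : CyclicInv a b i j M) (hM : 0 < M)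
    (ha : ∀ x y, x ≡ y [MOD M] → a x = a y) (hb : ∀ x y, x ≡ y [MOD M] → b x = b y) :
    ∃ Δ, ∀ x, a x = b (x + Δ) := by
  refine ⟨(M - 1) * i + j, fun x => ?_⟩
  have hi : i + (M - 1) * i = M * i := by
    obtain ⟨m, rfl⟩ : ∃ m, M = m + 1 := ⟨M - 1, by omega⟩
    simp; ring
  have hl : (x + (M - 1) * i) % M ≡ x + (M - 1) * i [MOD M] := Nat.mod_modEq _ _
  have h1 := h.agree ((x + (M - 1) * i) % M) (Nat.mod_lt _ hM)
  rw [ha _ (x + M * i), hb _ (x + ((M - 1) * i + j)), ha (x + M * i) x] at h1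
  · exact h1
  · simp [Nat.ModEq]
  · rw [← add_assoc, add_comm _ j]
    exact hl.add_left j
  · rw [← hi, add_left_comm]
    exact hl.add_left i

/-- If a were a shift of b, each shift of b would also be a shift of a. But a least shift of a
starts below M ≤ i, and the invariant provides a strictly smaller shift of b. -/
theorem not_exists_shift_of_le_left (h : CyclicInv a b i j k) (hM : 0 < M)
    (ha : ∀ x y, x ≡ y [MOD M] → a x = a y) (hb : ∀ x y, x ≡ y [MOD M] → b x = b y)
    (hi : M ≤ i) : ¬ ∃ Δ, ∀ x, a x = b (x + Δ) := by
  rintro ⟨Δ, hΔ⟩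
  obtain ⟨i₀, hi₀, hmin⟩ := Finset.exists_min_image (Finset.range M) (seqFrom a) ⟨0, by simpa⟩
  obtain ⟨j', hj'⟩ := h.left i₀ ((Finset.mem_range.1 hi₀).trans_le hi)
  have hcongr : ∀ x y, x ≡ y [MOD M] → seqFrom a x = seqFrom a y := fun x y hxy => by
    simp only [seqFrom]
    congr 1
    funext l
    exact ha _ _ (hxy.add_right l)
  have hb' : seqFrom b j' = seqFrom a (j' + (M - 1) * Δ) := by
    simp only [seqFrom]
    congr 1
    funext l
    rw [hΔ]
    apply hb
    have : j' + (M - 1) * Δ + l + Δ = j' + l + M * Δ := by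
      obtain ⟨m, rfl⟩ : ∃ m, M = m + 1 := ⟨M - 1, by omega⟩
      simp; ring
    rw [this]
    simp [Nat.ModEq]
  rw [hb', ← hcongr _ _ (Nat.mod_modEq _ M)] at hj'
  exact (hmin _ (Finset.mem_range.2 (Nat.mod_lt _ hM))).not_gt hj'

theorem not_exists_shift_of_le_right (h : CyclicInv a b i j k) (hM : 0 < M)
    (ha : ∀ x y, x ≡ y [MOD M] → a x = a y) (hb : ∀ x y, x ≡ y [MOD M] → b x = b y)
    (hj : M ≤ j) : ¬ ∃ Δ, ∀ x, a x = b (x + Δ) := by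
  rintro ⟨Δ, hΔ⟩
  refine h.symm.not_exists_shift_of_le_left hM hb ha hj ⟨(M - 1) * Δ, fun x => ?_⟩
  rw [hΔ]
  apply hb
  have : x + (M - 1) * Δ + Δ = x + M * Δ := by
    obtain ⟨m, rfl⟩ : ∃ m, M = m + 1 := ⟨M - 1, by omega⟩
    simp; ring
  rw [this]
  simp [Nat.ModEq]

end CyclicInv

/-! ### The blocks of the program and their effect on the registers -/

namespace LampMachine
open RAM RAM.Instr

/-- Loads the constants. -/
def initBlock : List Instr :=
  [const 1 1, const 20 2, const 21 3, const 22 4, const 23 32, const 28 8, const 29 10, const 30 24]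

/-- Reads a letter and counts it. -/
def countBlock : List Instr :=
  [read 3 2, sub 5 3 20, sub 6 3 21, sub 7 3 22, sub 5 5 6, sub 5 5 6, sub 6 6 7, sub 6 6 7,
    add 14 14 5, add 15 15 6, sub 5 5 4, sub 6 6 4, add 12 12 5, add 13 13 6, add 4 4 7, add 2 2 1,
    const 5 0, const 6 0, const 7 0]

/-- Computes the length of the cyclic configurations. -/
def lengthBlock : List Instr :=
  [sub 5 12 13, sub 6 13 12, add 5 5 6, sub 6 1 5, add 7 2 2, add 7 7 7, add 7 7 7, add 9 7 8,
    add 6 6 28, load 6 6, add 11 5 6, sub 9 11 1, const 2 0, const 4 0,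
    add 12 12 12, add 12 12 15, add 13 13 13, add 13 13 14, sub 14 12 13, sub 15 13 12,
    add 12 14 15, const 5 0, const 6 0, const 7 0, const 13 0, const 14 0, const 15 0]

/-- Reads a letter; switches a lamp or moves the lamplighter on the cycle. -/
def lampBlock : List Instr :=
  [read 3 2, sub 5 3 20, sub 6 3 21, sub 7 3 22, sub 19 1 3, add 19 19 5, sub 19 1 19,
    add 26 16 16, add 26 26 4, add 26 26 23, load 27 26, sub 31 27 19, sub 19 19 27, add 31 31 19,
    store 26 31, sub 5 5 6, sub 5 5 6, sub 6 6 7, sub 6 6 7, add 16 16 5, add 6 6 28, load 6 6,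
    add 16 16 6, sub 5 11 16, sub 5 1 5, add 5 5 29, load 5 5, sub 16 16 5, add 4 4 7, add 2 2 1,
    const 5 0, const 6 0, const 7 0, const 19 0, const 26 0, const 27 0, const 31 0]

/-- Prepares the comparison. -/
def resetBlock : List Instr := [const 2 0, const 3 0, const 4 0, const 16 0]

/-- One step of the comparison of two cyclic configurations. -/
def compareBlock : List Instr :=
  [add 5 16 18, sub 6 11 5, sub 6 1 6, add 6 6 29, load 6 6, sub 5 5 6,
    add 5 5 5, add 5 5 23, load 5 5,
    add 7 17 18, sub 6 11 7, sub 6 1 6, add 6 6 29, load 6 6, sub 7 7 6,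
    add 7 7 7, add 7 7 23, add 7 7 1, load 7 7,
    add 25 18 1, sub 6 5 7, sub 7 7 5, add 6 6 30, load 6 6, add 16 16 6,
    add 7 7 30, load 7 7, add 17 17 7, sub 18 25 6, sub 18 18 7,
    sub 5 11 16, sub 5 1 5, sub 6 11 17, sub 6 1 6, sub 7 11 18, sub 7 1 7,
    add 5 5 6, add 5 5 7, sub 5 1 5,
    const 6 0, const 7 0, const 25 0]

def answerBlock : List Instr := [sub 7 11 18, sub 0 1 7, sub 0 0 12]

/-- `1` for the code of `t`, and `0` for all other codes up to `5`. -/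
def isT (x : ℕ) : ℕ := x - 2 - (x - 3) - (x - 3)
/-- `1` for the code of `t⁻¹`, and `0` for all other codes up to `5`. -/
def isTInv (x : ℕ) : ℕ := x - 3 - (x - 4) - (x - 4)
/-- `1` for the codes of `a` and `a⁻¹`, and `0` for all other codes. -/
def isA (x : ℕ) : ℕ := 1 - (1 - x + (x - 2))

/-- The registers while the letters are counted. -/
def countRegs (q x w pu nu pt nt : ℕ) : ℕ → ℕ :=
  file [0, 1, q, x, w, 0, 0, 0, 0, 0, 0, 0, pu, nu, pt, nt, 0, 0, 0, 0, 2, 3, 4, 32, 0, 0, 0, 0,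
    8, 10, 24, 0] fun _ => 0

/-- The registers while the lamps are switched. -/
def lampRegs (M E q x w p : ℕ) (m : ℕ → ℕ) : ℕ → ℕ :=
  file [0, 1, q, x, w, 0, 0, 0, 0, M - 1, 0, M, E, 0, 0, 0, p, 0, 0, 0, 2, 3, 4, 32, 0, 0, 0, 0,
    8, 10, 24, 0] m

/-- The registers while the configurations are compared. -/
def compareRegs (M E i j k c : ℕ) (m : ℕ → ℕ) : ℕ → ℕ :=
  file [0, 1, 0, 0, 0, c, 0, 0, 0, M - 1, 0, M, E, 0, 0, 0, i, j, k, 0, 2, 3, 4, 32, 0, 0, 0, 0,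
    8, 10, 24, 0] m

theorem eval_initBlock (input : List ℕ) :
    evalBlock input initBlock (fun _ => 0) = countRegs 0 0 0 0 0 0 0 := by
  have : (fun _ => 0 : ℕ → ℕ) = file (List.replicate 32 0) fun _ => 0 := by
    funext i
    rcases lt_or_ge i 32 with h | h
    · rw [file_of_lt (by simpa), List.getElem_replicate]
    · rw [file_of_le (by simpa)]
  rw [this]
  simp [evalBlock, initBlock, Instr.effect, Instr.exec, update_file_of_lt, countRegs,
    List.replicate]

theorem eval_countBlock (input : List ℕ) (q x w pu nu pt nt : ℕ) :
    let y := input.getD q 0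
    evalBlock input countBlock (countRegs q x w pu nu pt nt) =
      countRegs (q + 1) y (w + (y - 4))
        (pu + (isT y - w)) (nu + (isTInv y - w)) (pt + isT y) (nt + isTInv y) := by
  simp [evalBlock, countBlock, Instr.effect, Instr.exec, update_file_of_lt, file_of_lt, countRegs,
    isT, isTInv]

/-- Indirect addressing replaces a conditional: a flag e added to a base address picks one of two
adjacent registers, which keeps the loop bodies free of jumps. -/
theorem file_select {l : List ℕ} {m : ℕ → ℕ} {e n : ℕ} (he : e ≤ 1) (hn : n + 1 < l.length) :
    file l m (e + n) = if e = 0 then l[n] else l[n + 1] := by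
  interval_cases e
  · simp [file_of_lt (show n < l.length by omega)]
  · simp [add_comm 1 n, file_of_lt hn]

theorem file_select_sub {l : List ℕ} {m : ℕ → ℕ} {x y n : ℕ} (hx : x ≤ 1) (hn : n + 1 < l.length) :
    file l m (x - y + n) = if x - y = 0 then l[n] else l[n + 1] :=
  file_select (by omega) hn

theorem file_select_isTInv {l : List ℕ} {m : ℕ → ℕ} {y n : ℕ} (hn : n + 1 < l.length) :
    file l m (y - 3 - (y - 4) - (y - 4) + n) =
      if y - 3 - (y - 4) - (y - 4) = 0 then l[n] else l[n + 1] :=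
  file_select (by omega) hn

/-- With pu, nu counted in the first word and pt, nt in both, the cycle length is |δ₁|, or 8q if δ₁
= 0. The second value is |2δ₁ - (δ₁ + δ₂)| = |δ₁ - δ₂|, which vanishes exactly when the positions
agree. -/
theorem eval_lengthBlock (input : List ℕ) (q x w pu nu pt nt : ℕ) :
    evalBlock input lengthBlock (countRegs q x w pu nu pt nt) =
      lampRegs (pu - nu + (nu - pu) + if pu - nu + (nu - pu) = 0 then 8 * q else 0)
        (pu + pu + nt - (nu + nu + pt) + (nu + nu + pt - (pu + pu + nt))) 0 x 0 0 fun _ => 0 := by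
  have h8 : q + q + (q + q) + (q + q + (q + q)) = 8 * q := by ring
  by_cases h : pu - nu + (nu - pu) = 0
  · have h1 : 1 - (pu - nu + (nu - pu)) = 1 := by omega
    simp only [evalBlock, lengthBlock, Instr.effect, Instr.exec, update_file_of_lt, file_of_lt, countRegs,
      lampRegs, h, h8, List.foldl, List.set, List.length, List.getElem_cons_succ, List.getElem_cons_zero,
      Nat.reduceAdd, Nat.reduceLT, Nat.reduceSub, if_true]
    simp
  · have h1 : 1 - (pu - nu + (nu - pu)) = 0 := by omega
    simp [evalBlock, lengthBlock, Instr.effect, Instr.exec, update_file_of_lt, file_of_lt, countRegs,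
      lampRegs, h, h1, h8, -Nat.add_eq_zero_iff]

/-- A step to the left adds M - 1, and one conditional subtraction of M reduces the position. On
bits |v - isA y| is exclusive or. The two words use the even and the odd cells from 32 on. -/
theorem eval_lampBlock (input : List ℕ) (M E q x w p : ℕ) (m : ℕ → ℕ) :
    let y := input.getD q 0
    let p' := p + isT y + if isTInv y = 0 then 0 else M - 1
    let v := m (p + p + w + 32)
    evalBlock input lampBlock (lampRegs M E q x w p m) =
      lampRegs M E (q + 1) y (w + (y - 4)) (p' - if 1 - (M - p') = 0 then 0 else M)
        (Function.update m (p + p + w + 32) (v - isA y + (isA y - v))) := by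
  intro y p' v
  simp [evalBlock, lampBlock, Instr.effect, Instr.exec, update_file_of_lt, file_of_lt, lampRegs,
    isT, isTInv, isA, update_file_of_le, file_of_le, file_select_sub, file_select_isTInv, y,
    p', v]

theorem eval_resetBlock (input : List ℕ) (M E q x w p : ℕ) (m : ℕ → ℕ) :
    evalBlock input resetBlock (lampRegs M E q x w p m) = compareRegs M E 0 0 0 0 m := by
  simp [evalBlock, resetBlock, Instr.effect, Instr.exec, update_file_of_lt, lampRegs, compareRegs]

/-- Since x and y are bits, the truncated differences x - y and y - x serve as flags for a mismatch
and its direction. Register 5 ends as a flag that i, j and k are all still below M. -/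
theorem eval_compareBlock (input : List ℕ) (M E i j k c : ℕ) (m : ℕ → ℕ) :
    let i' := i + k - if 1 - (M - (i + k)) = 0 then 0 else M
    let j' := j + k - if 1 - (M - (j + k)) = 0 then 0 else M
    let x := m (i' + i' + 32)
    let y := m (j' + j' + 32 + 1)
    let di := if x - y = 0 then 0 else k + 1
    let dj := if y - x = 0 then 0 else k + 1
    x ≤ 1 → y ≤ 1 →
    evalBlock input compareBlock (compareRegs M E i j k c m) =
      compareRegs M E (i + di) (j + dj) (k + 1 - di - dj)
        (1 - (1 - (M - (i + di)) + (1 - (M - (j + dj))) + (1 - (M - (k + 1 - di - dj))))) m := by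
  intro i' j' x y di dj hx hy
  simp only [x, y, i', j'] at hx hy
  simp [evalBlock, compareBlock, Instr.effect, Instr.exec, update_file_of_lt, file_of_lt,
    compareRegs, file_of_le, file_select_sub, hx, hy, di, dj, x, y, i', j']

theorem eval_answerBlock (input : List ℕ) (M E i j k c : ℕ) (m : ℕ → ℕ) :
    evalBlock input answerBlock (compareRegs M E i j k c m) 0 = 1 - (M - k) - E := by
  simp [evalBlock, answerBlock, Instr.effect, Instr.exec, update_file_of_lt, file_of_lt,
    compareRegs]

end LampMachine

/-! ### What the passes over the input and the comparison compute -/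

namespace LampMachine
open RAM RAM.Instr

theorem isT_le (y : ℕ) : isT y ≤ 1 := by unfold isT; omega
theorem isTInv_le (y : ℕ) : isTInv y ≤ 1 := by unfold isTInv; omega
theorem isA_le (y : ℕ) : isA y ≤ 1 := by unfold isA; omega

/-- Occurrences of `t` and `t⁻¹`: `w` is the number of separators read, `pu` and `nu` count in the
first word, and `pt` and `nt` in both words. -/
structure Counts where
  w : ℕ
  pu : ℕ
  nu : ℕ
  pt : ℕ
  nt : ℕ

/-- Read the letter with code `y`. -/
def Counts.step (s : Counts) (y : ℕ) : Counts :=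
  ⟨s.w + (y - 4), s.pu + (isT y - s.w), s.nu + (isTInv y - s.w), s.pt + isT y, s.nt + isTInv y⟩

/-- The number of letters `t` in a word. -/
def countT (u : List LampLetter) : ℕ := (u.map fun l => isT l.code).sum

/-- The number of letters `t⁻¹` in a word. -/
def countTInv (u : List LampLetter) : ℕ := (u.map fun l => isTInv l.code).sum

theorem code_sub_four (l : LampLetter) : l.code - 4 = 0 := by cases l <;> rfl

theorem foldl_counts_zero (u : List LampLetter) (pu nu pt nt : ℕ) :
    (u.map LampLetter.code).foldl Counts.step ⟨0, pu, nu, pt, nt⟩ =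
      ⟨0, pu + countT u, nu + countTInv u, pt + countT u, nt + countTInv u⟩ := by
  induction u generalizing pu nu pt nt with
  | nil => simp [countT, countTInv]
  | cons l u ih =>
    simp only [List.map_cons, List.foldl_cons, Counts.step, code_sub_four, add_zero, Nat.sub_zero,
      ih, countT, countTInv, List.sum_cons, add_assoc]

theorem foldl_counts_one (u : List LampLetter) (pu nu pt nt : ℕ) :
    (u.map LampLetter.code).foldl Counts.step ⟨1, pu, nu, pt, nt⟩ =
      ⟨1, pu, nu, pt + countT u, nt + countTInv u⟩ := by
  induction u generalizing pt nt with
  | nil => simp [countT, countTInv]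
  | cons l u ih =>
    simp only [List.map_cons, List.foldl_cons, Counts.step, code_sub_four, add_zero,
      Nat.sub_eq_zero_of_le (isT_le _), Nat.sub_eq_zero_of_le (isTInv_le _),
      ih, countT, countTInv, List.sum_cons, add_assoc]

theorem foldl_counts_pair (u v : List LampLetter) :
    Counts.step ((lampPairCode u v).foldl Counts.step ⟨0, 0, 0, 0, 0⟩) 0 =
      ⟨1, countT u, countTInv u, countT u + countT v, countTInv u + countTInv v⟩ := by
  rw [lampPairCode, List.foldl_append, foldl_counts_zero, List.foldl_cons]
  simp only [Counts.step, isT, isTInv, zero_add, Nat.reduceSub, add_zero, Nat.sub_zero]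
  rw [foldl_counts_one]
  simp

theorem genA_inv : Lamplighter.genA⁻¹ = Lamplighter.genA := by
  ext x
  · simp [Lamplighter.genA]
  · simp [Lamplighter.genA, ZMod.neg_eq_self_mod_two]

theorem pos_lampWordVal (u : List LampLetter) :
    (lampWordVal u).pos = countT u - countTInv u := by
  induction u with
  | nil => simp [countT, countTInv]
  | cons l u ih =>
    have h : lampWordVal (l :: u) = l.val * lampWordVal u := by simp [lampWordVal]
    have hl : l.val.pos = isT l.code - isTInv l.code := by
      cases l <;> simp [LampLetter.val, LampLetter.code, isT, isTInv, Lamplighter.genA,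
        Lamplighter.genT]
    simp only [h, Lamplighter.mul_pos', ih, hl, countT, countTInv, List.map_cons, List.sum_cons]
    push_cast
    ring

/-- The state of the second pass: the word, the position on the cycle and the lamps. -/
structure LampState where
  w : ℕ
  p : ℕ
  m : ℕ → ℕ

/-- Read the letter with code `y`, on the cycle of length `M`. -/
def LampState.step (M : ℕ) (s : LampState) (y : ℕ) : LampState :=
  let p' := s.p + isT y + if isTInv y = 0 then 0 else M - 1
  let v := s.m (s.p + s.p + s.w + 32)
  ⟨s.w + (y - 4), p' - if 1 - (M - p') = 0 then 0 else M,
    Function.update s.m (s.p + s.p + s.w + 32) (v - isA y + (isA y - v))⟩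

/-- The position lies on the cycle, and every lamp is off or on. -/
structure LampState.Valid (M : ℕ) (s : LampState) : Prop where
  p_lt : s.p < M
  m_le : ∀ i, s.m i ≤ 1

theorem LampState.Valid.step {M : ℕ} {s : LampState} (h : s.Valid M) (y : ℕ) :
    (s.step M y).Valid M := by
  obtain ⟨h1, h2⟩ := h
  constructor
  · have h3 : s.p + isT y + (if isTInv y = 0 then 0 else M - 1) < 2 * M := by
      unfold isT isTInv
      split_ifs <;> omega
    simp only [LampState.step]
    generalize s.p + isT y + (if isTInv y = 0 then 0 else M - 1) = p' at h3
    split_ifs <;> omega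
  · intro i
    simp only [LampState.step, Function.update_apply]
    have := isA_le y
    have := h2 (s.p + s.p + s.w + 32)
    split_ifs
    · omega
    · exact h2 i

theorem natCast_reduce (M p : ℕ) :
    ((p - if 1 - (M - p) = 0 then 0 else M : ℕ) : ZMod M) = p := by
  split_ifs with h
  · simp
  · rw [Nat.cast_sub (by omega)]
    simp

theorem LampState.step_p {M : ℕ} (hM : 0 < M) (s : LampState) (l : LampLetter) :
    ((s.step M l.code).p : ZMod M) = s.p + l.val.pos := by
  have hM1 : ((M - 1 : ℕ) : ZMod M) = -1 := by
    rw [Nat.cast_sub hM]; simp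
  simp only [LampState.step]
  rw [natCast_reduce]
  cases l <;> simp [LampLetter.val, LampLetter.code, isT, isTInv, Lamplighter.genA,
    Lamplighter.genT, hM1]

theorem LampState.step_m_of_isA_eq_zero {M : ℕ} (s : LampState) {y : ℕ} (h : isA y = 0) :
    (s.step M y).m = s.m := by
  simp [LampState.step, h]

theorem LampState.step_separator {M : ℕ} {s : LampState} (h : s.Valid M) :
    s.step M 5 = ⟨s.w + 1, s.p, s.m⟩ := by
  have hp := h.p_lt
  have : 1 - (M - s.p) = 0 := by omega
  simp [LampState.step, isA, isT, isTInv, this]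

theorem LampState.step_end {M : ℕ} {s : LampState} (h : s.Valid M) : s.step M 0 = s := by
  have hp := h.p_lt
  have : 1 - (M - s.p) = 0 := by omega
  simp [LampState.step, isA, isT, isTInv, this]

/-- Running through a word computes its projection to the cycle. -/
theorem foldl_lamps {M : ℕ} {s₀ : LampState} (h₀ : s₀.Valid M) (hp₀ : (s₀.p : ZMod M) = 0)
    (hw₀ : s₀.w ≤ 1) (hm₀ : ∀ y, s₀.m (y + y + s₀.w + 32) = 0) (u : List LampLetter) :
    let s := (u.map LampLetter.code).foldl (LampState.step M) s₀
    s.Valid M ∧ s.w = s₀.w ∧ (s.p : ZMod M) = (lampWordVal u).pos ∧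
      (∀ y < M, ((s.m (y + y + s₀.w + 32) : ℕ) : ZMod 2) =
        lampProj M (lampWordVal u).lamps ((y : ZMod M) - s.p)) ∧
      ∀ y, s.m (y + y + (1 - s₀.w) + 32) = s₀.m (y + y + (1 - s₀.w) + 32) := by
  have hM : 0 < M := (Nat.zero_le _).trans_lt h₀.p_lt
  induction u using List.reverseRecOn with
  | nil => exact ⟨h₀, rfl, by simpa using hp₀, fun y _ => by simp [hm₀, lampProj], fun y => rfl⟩
  | append_singleton u l ih =>
    simp only [List.map_append, List.map_cons, List.map_nil, List.foldl_append, List.foldl_cons,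
      List.foldl_nil, lampWordVal_concat]
    generalize (u.map LampLetter.code).foldl (LampState.step M) s₀ = s at ih ⊢
    obtain ⟨hs, hw, hp, hm, hm'⟩ := ih
    refine ⟨hs.step _, ?_, ?_, ?_, ?_⟩
    · simp [LampState.step, code_sub_four, hw]
    · rw [LampState.step_p hM, hp]
      simp
    · intro y hy
      rw [LampState.step_p hM, Lamplighter.mul_lamps, lampProj_add, lampProj_lampShift,
        Finsupp.add_apply, lampShift_apply]
      -- The array keeps lamps in fixed coordinates, whereas the configuration of a product is seen
      -- from the lamplighter's final position; the two displacements cancel.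
      have hshift : (y : ZMod M) - (s.p + l.val.pos) + l.val.pos = y - s.p := by ring
      rw [hshift, ← hm y hy]
      have hA : isA l.code = 1 → l.val = Lamplighter.genA →
          (((s.step M l.code).m (y + y + s₀.w + 32) : ℕ) : ZMod 2) =
            (s.m (y + y + s₀.w + 32) : ℕ) +
              lampProj M l.val.lamps ((y : ZMod M) - (s.p + l.val.pos)) := by
        intro h1 h2
        rw [h2]
        simp only [Lamplighter.genA, lampProj_single, LampState.step, h1, hw]
        by_cases hyp : y = s.p
        · subst hyp
          have := hs.m_le (s.p + s.p + s₀.w + 32)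
          interval_cases s.m (s.p + s.p + s₀.w + 32)
          · simp
          · simp [show (1 + 1 : ZMod 2) = 0 from rfl]
        · have hne : (y : ZMod M) - (s.p + ((0 : ℤ) : ZMod M)) ≠ 0 := by
            rw [Int.cast_zero, add_zero, sub_ne_zero, Ne, ZMod.natCast_eq_natCast_iff',
              Nat.mod_eq_of_lt hy, Nat.mod_eq_of_lt hs.p_lt]
            exact hyp
          rw [Function.update_of_ne (by omega), Int.cast_zero, Finsupp.single_eq_of_ne (by
            simpa using hne), add_zero]
      cases l with
      | a => exact hA rfl rfl
      | aInv => exact hA rfl genA_inv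
      | t =>
        rw [LampState.step_m_of_isA_eq_zero _ rfl]
        simp [LampLetter.val, Lamplighter.genT, lampProj]
      | tInv =>
        rw [LampState.step_m_of_isA_eq_zero _ rfl]
        simp [LampLetter.val, Lamplighter.genT, lampProj,
          show lampShift (0 : Lamps ℤ) (-1) = 0 by ext; simp]
    · intro y
      rw [← hm' y]
      simp only [LampState.step, hw]
      rw [Function.update_of_ne (by omega)]

/-- The position needs no reset between the words: that of u is 0 modulo M, so the second walk also
starts at 0. The array of v stays rotated by the position of v, which is harmless when the two
positions agree. -/
theorem foldl_lamps_pair {M : ℕ} (hM : 0 < M) {u v : List LampLetter}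
    (hu : ((lampWordVal u).pos : ZMod M) = 0) :
    let s := LampState.step M
      ((lampPairCode u v).foldl (LampState.step M) ⟨0, 0, fun _ => 0⟩) 0
    (∀ y < M, ((s.m (y + y + 32) : ℕ) : ZMod 2) = lampProj M (lampWordVal u).lamps y) ∧
      ∀ y < M, ((s.m (y + y + 33) : ℕ) : ZMod 2) =
        lampProj M (lampWordVal v).lamps ((y : ZMod M) - (lampWordVal v).pos) := by
  obtain ⟨h1, h2, h3, h4, h5⟩ := foldl_lamps (M := M) (s₀ := ⟨0, 0, fun _ => 0⟩)
    ⟨hM, by simp⟩ (by simp) (by simp) (by simp) u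
  rw [lampPairCode, List.foldl_append, List.foldl_cons]
  generalize (u.map LampLetter.code).foldl (LampState.step M) ⟨0, 0, fun _ => 0⟩ = s at *
  rw [LampState.step_separator h1]
  have h1' : LampState.Valid M ⟨s.w + 1, s.p, s.m⟩ := ⟨h1.p_lt, h1.m_le⟩
  simp only at h2 h3 h4 h5
  obtain ⟨k1, k2, k3, k4, k5⟩ := foldl_lamps h1' (by rw [← hu]; exact h3) (by simp [h2])
    (by intro y; simpa [h2] using h5 y) v
  simp only [h2, zero_add] at k1 k2 k3 k4 k5 ⊢
  generalize (v.map LampLetter.code).foldl (LampState.step M) ⟨1, s.p, s.m⟩ = s' at *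
  rw [LampState.step_end k1]
  refine ⟨fun y hy => ?_, fun y hy => ?_⟩
  · have := k5 y
    simp only [Nat.sub_self, add_zero] at this
    rw [this]
    have := h4 y hy
    rw [h3, hu, sub_zero] at this
    exact this
  · rw [← k3]
    exact k4 y hy

/-- The state `(i, j, k)` of the comparison of the two arrays, in registers. -/
def CompareInv (M E : ℕ) (m : ℕ → ℕ) (i j k : ℕ) (r : ℕ → ℕ) : Prop :=
  CyclicInv (fun x => m (x % M + x % M + 32)) (fun x => m (x % M + x % M + 33)) i j k ∧
    ∃ c ≤ 1, r = compareRegs M E i j k c m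

theorem sub_select_eq_mod {M x : ℕ} (hx : x < 2 * M) :
    (x - if 1 - (M - x) = 0 then 0 else M) = x % M := by
  split_ifs with h
  · rw [Nat.mod_eq_of_lt (by omega), Nat.sub_zero]
  · rw [Nat.mod_eq_sub_mod (by omega), Nat.mod_eq_of_lt (by omega)]

/-- The sum i + j + k is the potential behind the linear running time: a mismatch trades the k
matched entries and the current one for an advance of k + 1 ≤ M. -/
theorem compareInv_step (input : List ℕ) {M E i j k : ℕ} {m r : ℕ → ℕ} (hm : ∀ i, m i ≤ 1)
    (hi : i < M) (hj : j < M) (hk : k < M) (h : CompareInv M E m i j k r) :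
    ∃ i' j' k', i' + j' + k' = i + j + k + 1 ∧ i' ≤ 2 * M ∧ j' ≤ 2 * M ∧ k' ≤ M ∧
      CompareInv M E m i' j' k' (evalBlock input compareBlock r) ∧
      (0 < evalBlock input compareBlock r 5 ↔ i' < M ∧ j' < M ∧ k' < M) := by
  obtain ⟨hinv, c, hc, rfl⟩ := h
  have heval := eval_compareBlock input M E i j k c m (hm _) (hm _)
  rw [sub_select_eq_mod (by omega), sub_select_eq_mod (by omega)] at heval
  have hx := hm ((i + k) % M + (i + k) % M + 32)
  have hy := hm ((j + k) % M + (j + k) % M + 32 + 1)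
  have key : ∀ i' j' k', evalBlock input compareBlock (compareRegs M E i j k c m) =
      compareRegs M E i' j' k' (1 - (1 - (M - i') + (1 - (M - j')) + (1 - (M - k')))) m →
      CyclicInv (fun x => m (x % M + x % M + 32)) (fun x => m (x % M + x % M + 33)) i' j' k' →
      i' + j' + k' = i + j + k + 1 → i' ≤ 2 * M → j' ≤ 2 * M → k' ≤ M →
      ∃ i' j' k', i' + j' + k' = i + j + k + 1 ∧ i' ≤ 2 * M ∧ j' ≤ 2 * M ∧ k' ≤ M ∧
        CompareInv M E m i' j' k' (evalBlock input compareBlock (compareRegs M E i j k c m)) ∧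
        (0 < evalBlock input compareBlock (compareRegs M E i j k c m) 5 ↔
          i' < M ∧ j' < M ∧ k' < M) := by
    intro i' j' k' he hI h1 h2 h3 h4
    refine ⟨i', j', k', h1, h2, h3, h4, ⟨hI, _, by omega, he⟩, ?_⟩
    rw [he, compareRegs, file_of_lt (by simp)]
    simp only [List.getElem_cons_succ, List.getElem_cons_zero]
    omega
  rcases lt_trichotomy (m ((i + k) % M + (i + k) % M + 32))
    (m ((j + k) % M + (j + k) % M + 32 + 1)) with hlt | heq | hgt
  · rw [if_pos (by omega), if_neg (by omega)] at heval
    exact key i (j + (k + 1)) 0 (by simpa using heval) (hinv.step_lt hlt) (by omega) (by omega)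
      (by omega) (by omega)
  · rw [if_pos (by omega), if_pos (by omega)] at heval
    exact key i j (k + 1) (by simpa using heval) (hinv.step_eq heq) (by omega) (by omega)
      (by omega) (by omega)
  · rw [if_neg (by omega), if_pos (by omega)] at heval
    exact key (i + (k + 1)) j 0 (by simpa using heval) (hinv.step_gt hgt) (by omega) (by omega)
      (by omega) (by omega)

theorem exists_lampShift_iff_of_arrays {M : ℕ} [NeZero M] {m : ℕ → ℕ} (hm : ∀ i, m i ≤ 1)
    {f g : Lamps (ZMod M)} (hf : ∀ y < M, ((m (y + y + 32) : ℕ) : ZMod 2) = f y)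
    (hg : ∀ y < M, ((m (y + y + 33) : ℕ) : ZMod 2) = g y) :
    (∃ Δ : ℤ, f = lampShift g (Δ : ZMod M)) ↔
      ∃ Δ : ℕ, ∀ x, m (x % M + x % M + 32) = m ((x + Δ) % M + (x + Δ) % M + 33) := by
  have hM : 0 < M := Nat.pos_of_neZero M
  have hf' : ∀ x : ℕ, ((m (x % M + x % M + 32) : ℕ) : ZMod 2) = f x := fun x => by
    rw [hf _ (Nat.mod_lt _ hM), ZMod.natCast_mod]
  have hg' : ∀ x : ℕ, ((m (x % M + x % M + 33) : ℕ) : ZMod 2) = g x := fun x => by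
    rw [hg _ (Nat.mod_lt _ hM), ZMod.natCast_mod]
  constructor
  · rintro ⟨Δ, h⟩
    refine ⟨(Δ : ZMod M).val, fun x => ?_⟩
    have h1 : ((m (x % M + x % M + 32) : ℕ) : ZMod 2) =
        (m ((x + (Δ : ZMod M).val) % M + (x + (Δ : ZMod M).val) % M + 33) : ℕ) := by
      rw [hf', hg', h, lampShift_apply]
      simp
    -- Both entries are at most 1, so congruence modulo 2 is equality.
    rw [ZMod.natCast_eq_natCast_iff'] at h1
    have h2 := hm (x % M + x % M + 32)
    have h3 := hm ((x + (Δ : ZMod M).val) % M + (x + (Δ : ZMod M).val) % M + 33)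
    omega
  · rintro ⟨Δ, h⟩
    refine ⟨Δ, ?_⟩
    ext x
    have h1 := hf' x.val
    rw [h, hg', ZMod.natCast_zmod_val] at h1
    rw [← h1, lampShift_apply]
    simp

end LampMachine

/-! ### The whole program, its running time and its register bound -/

namespace LampMachine
open RAM RAM.Instr

/-- The machine that decides conjugacy in the lamplighter group. -/
def program : Program :=
  -- The blocks start at 0, 8, 28, 55, 93, 97 and 140; each jump returns to the start of its own
  -- loop.
  initBlock ++ (countBlock ++ [jumpPos 3 8]) ++ lengthBlock ++ (lampBlock ++ [jumpPos 3 55]) ++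
    resetBlock ++ (compareBlock ++ [jumpPos 5 97]) ++ answerBlock

theorem length_program : program.length = 143 := by
  simp [program, initBlock, countBlock, lengthBlock, lampBlock, resetBlock, compareBlock, answerBlock]

theorem length_lampPairCode (u v : List LampLetter) :
    (lampPairCode u v).length = u.length + v.length + 1 := by
  simp [lampPairCode, add_assoc]

theorem mem_lampPairCode {u v : List LampLetter} {x : ℕ} (hx : x ∈ lampPairCode u v) :
    0 < x ∧ x ≤ 5 := by
  have : ∀ l : LampLetter, 0 < l.code ∧ l.code ≤ 5 := fun l => by cases l <;> simp [LampLetter.code]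
  simp only [lampPairCode, List.mem_append, List.mem_map, List.mem_cons] at hx
  obtain ⟨l, -, rfl⟩ | rfl | ⟨l, -, rfl⟩ := hx
  · exact this l
  · simp
  · exact this l

theorem getD_lampPairCode_le (u v : List LampLetter) (q : ℕ) :
    (lampPairCode u v).getD q 0 ≤ 5 := by
  rcases lt_or_ge q (lampPairCode u v).length with h | h
  · rw [List.getD_eq_getElem _ _ h]
    exact (mem_lampPairCode (List.getElem_mem h)).2
  · rw [List.getD_eq_default _ _ h]
    simp

variable (u v : List LampLetter) {b : ℕ}

/-- No counter exceeds the number of reads, which keeps the registers below b. The |u| + |v| + 2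
reads are the letters, the separator and the final 0. -/
theorem reaches_count (hb : 32 + u.length + v.length ≤ b) :
    countT u + countT v ≤ u.length + v.length + 2 ∧
    countTInv u + countTInv v ≤ u.length + v.length + 2 ∧
    ∃ t ≤ (u.length + v.length + 2) * 20, ∃ x ≤ 5,
      Reaches program (lampPairCode u v) (2 ^ 19 * b) ⟨8, countRegs 0 0 0 0 0 0 0⟩ t
        ⟨28, countRegs (u.length + v.length + 2) x 1 (countT u) (countTInv u)
          (countT u + countT v) (countTInv u + countTInv v)⟩ := by
  have hlen := length_lampPairCode u v
  obtain ⟨t, ht, r, ⟨⟨x, hx, rfl⟩, h1, h2, h3, h4, h5⟩, hreach⟩ :=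
    reaches_inputLoop (P := program) (K := 32) (b := b) (o := 8) (blk := countBlock) (j := 3)
      (input := lampPairCode u v) (g := Counts.step) (s₀ := ⟨0, 0, 0, 0, 0⟩)
      (R := fun q s r => (∃ x ≤ 5, r = countRegs q x s.w s.pu s.nu s.pt s.nt) ∧
        s.w ≤ q ∧ s.pu ≤ q ∧ s.nu ≤ q ∧ s.pt ≤ q ∧ s.nt ≤ q)
      (r := countRegs 0 0 0 0 0 0 0)
      ⟨_, rfl⟩ (by simp [countBlock, Instr.Straight]) (by omega)
      (fun x hx => (mem_lampPairCode hx).2.trans (by omega)) (fun x hx => (mem_lampPairCode hx).1)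
      (by
        rintro q s r hq ⟨⟨x, hx, rfl⟩, h1, h2, h3, h4, h5⟩ i
        refine file_le ?_ (fun _ => by omega) i
        simp only [List.forall_mem_cons, List.not_mem_nil, IsEmpty.forall_iff,
          implies_true, and_true]
        omega)
      (by
        rintro q r hq ⟨⟨x, hx, rfl⟩, h1, h2, h3, h4, h5⟩
        generalize List.foldl _ _ _ = s at *
        have hy := getD_lampPairCode_le u v q
        have hT := isT_le ((lampPairCode u v).getD q 0)
        have hT' := isTInv_le ((lampPairCode u v).getD q 0)
        rw [eval_countBlock]
        refine ⟨by simp [countRegs, file], ⟨_, hy, rfl⟩, ?_⟩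
        simp only [Counts.step]
        omega)
      ⟨⟨0, by simp, rfl⟩, by simp⟩
  rw [foldl_counts_pair] at *
  rw [hlen] at *
  exact ⟨h4, h5, t, ht, x, hx, hreach⟩

theorem reaches_lamps {M E : ℕ} (hM : 0 < M) (x₀ : ℕ) (hx₀ : x₀ ≤ 5)
    (hb : 32 + u.length + v.length + M + E ≤ b) :
    ∃ s : LampState, s = LampState.step M
      ((lampPairCode u v).foldl (LampState.step M) ⟨0, 0, fun _ => 0⟩) 0 ∧ s.Valid M ∧
    ∃ t ≤ (u.length + v.length + 2) * 38, ∃ x ≤ 5, s.w ≤ u.length + v.length + 2 ∧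
      Reaches program (lampPairCode u v) (2 ^ 37 * b) ⟨55, lampRegs M E 0 x₀ 0 0 fun _ => 0⟩ t
        ⟨93, lampRegs M E (u.length + v.length + 2) x s.w s.p s.m⟩ := by
  have hlen := length_lampPairCode u v
  obtain ⟨t, ht, r, ⟨⟨x, hx, rfl⟩, h1, h2⟩, hreach⟩ :=
    reaches_inputLoop (P := program) (K := 32) (b := b) (o := 55) (blk := lampBlock) (j := 3)
      (input := lampPairCode u v) (g := LampState.step M) (s₀ := ⟨0, 0, fun _ => 0⟩)
      (R := fun q s r => (∃ x ≤ 5, r = lampRegs M E q x s.w s.p s.m) ∧ s.w ≤ q ∧ s.Valid M)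
      (r := lampRegs M E 0 x₀ 0 0 fun _ => 0)
      ⟨_, rfl⟩ (by simp [lampBlock, Instr.Straight]) (by omega)
      (fun x hx => (mem_lampPairCode hx).2.trans (by omega)) (fun x hx => (mem_lampPairCode hx).1)
      (by
        rintro q s r hq ⟨⟨x, hx, rfl⟩, h1, h2, h3⟩ i
        refine file_le ?_ (fun i => (h3 i).trans (by omega)) i
        simp only [List.forall_mem_cons, List.not_mem_nil, IsEmpty.forall_iff,
          implies_true, and_true]
        omega)
      (by
        rintro q r hq ⟨⟨x, hx, rfl⟩, h1, h2⟩
        generalize List.foldl _ _ _ = s at *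
        have hy := getD_lampPairCode_le u v q
        rw [eval_lampBlock]
        refine ⟨by simp [lampRegs, file], ⟨_, hy, rfl⟩, ?_, h2.step _⟩
        simp only [LampState.step]
        omega)
      ⟨⟨x₀, hx₀, rfl⟩, by simp, hM, by simp⟩
  rw [hlen] at *
  exact ⟨_, rfl, h2, t, ht, x, hx, h1, hreach⟩

theorem reaches_compare {M E : ℕ} (hM : 0 < M) {m : ℕ → ℕ} (hm : ∀ i, m i ≤ 1)
    (hb : 32 + 2 * M + E ≤ b) :
    ∃ t ≤ (3 * M + 1) * 43, ∃ i j k r, k ≤ M ∧ i ≤ 2 * M ∧ j ≤ 2 * M ∧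
      (M ≤ i ∨ M ≤ j ∨ M ≤ k) ∧ CompareInv M E m i j k r ∧
      Reaches program (lampPairCode u v) (2 ^ 42 * b) ⟨97, compareRegs M E 0 0 0 0 m⟩ t
        ⟨140, r⟩ := by
  have hbound : ∀ {i j k r}, i ≤ 2 * M → j ≤ 2 * M → k ≤ M → CompareInv M E m i j k r →
      ∀ a, r a ≤ b := by
    rintro i j k r hi hj hk ⟨-, c, hc, rfl⟩ a
    refine file_le ?_ (fun i => (hm i).trans (by omega)) a
    simp only [List.forall_mem_cons, List.not_mem_nil, IsEmpty.forall_iff,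
          implies_true, and_true]
    omega
  obtain ⟨t, ht, r, ⟨i, j, k, hk, hi, hj, hor, hinv⟩, hreach⟩ :=
    reaches_loop (P := program) (K := 32) (b := b) (o := 97) (blk := compareBlock) (j := 5)
      (input := lampPairCode u v)
      -- The decreasing measure is 3M - (i + j + k), positive as long as all three indices stay
      -- below M.
      (Inv := fun n r => ∃ i j k, n + (i + j + k) = 3 * M ∧ i < M ∧ j < M ∧ k < M ∧
        CompareInv M E m i j k r)
      (Post := fun r => ∃ i j k, k ≤ M ∧ i ≤ 2 * M ∧ j ≤ 2 * M ∧
        (M ≤ i ∨ M ≤ j ∨ M ≤ k) ∧ CompareInv M E m i j k r)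
      ⟨_, rfl⟩ (by simp [compareBlock, Instr.Straight]) (by omega)
      (fun x hx => (mem_lampPairCode hx).2.trans (by omega))
      (by
        rintro n r ⟨i, j, k, -, hi, hj, hk, hinv⟩
        exact hbound (by omega) (by omega) hk.le hinv)
      (by
        rintro n r ⟨i, j, k, hn, hi, hj, hk, hinv⟩
        obtain ⟨i', j', k', hsum, hi', hj', hk', hinv', hiff⟩ :=
          compareInv_step (lampPairCode u v) hm hi hj hk hinv
        rcases Nat.eq_zero_or_pos (evalBlock (lampPairCode u v) compareBlock r 5) with h0 | h0
        · refine Or.inl ⟨h0, i', j', k', hk', hi', hj', ?_, hinv'⟩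
          omega
        · obtain ⟨h1, h2, h3⟩ := hiff.1 h0
          exact Or.inr ⟨h0, n - 1, by omega, i', j', k', by omega, h1, h2, h3, hinv'⟩)
      (3 * M) (compareRegs M E 0 0 0 0 m)
      ⟨0, 0, 0, by simp, hM, hM, hM, CyclicInv.zero _ _, 0, by simp, rfl⟩
  exact ⟨t, ht, i, j, k, r, hk, hi, hj, hor, hinv, hreach⟩

theorem decidesWithin_program :
    DecidesWithin program (lampPairCode u v) (IsConj (lampWordVal u) (lampWordVal v))
      (2 ^ 60 * (u.length + v.length + 1)) := by
  set N := u.length + v.length + 2 with hN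
  set δ : ℤ := (lampWordVal u).pos with hδ
  set M := countT u - countTInv u + (countTInv u - countT u) +
    if countT u - countTInv u + (countTInv u - countT u) = 0 then 8 * N else 0 with hMdef
  set E := countT u + countT u + (countTInv u + countTInv v) -
    (countTInv u + countTInv u + (countT u + countT v)) +
    (countTInv u + countTInv u + (countT u + countT v) -
    (countT u + countT u + (countTInv u + countTInv v))) with hEdef
  have hδu : δ = countT u - countTInv u := pos_lampWordVal u
  have hδv := pos_lampWordVal v
  have hMc : M = cyclicLength δ N := by
    rw [cyclicLength, hMdef, hδu]
    split_ifs <;> omega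
  have hE : E = 0 ↔ δ = (lampWordVal v).pos := by omega
  have hM : 0 < M := by
    rw [hMdef]
    split_ifs <;> omega
  have : NeZero M := ⟨hM.ne'⟩
  have hδM : (δ : ZMod M) = 0 := by
    rw [ZMod.intCast_zmod_eq_zero_iff_dvd, hMc, cyclicLength]
    split_ifs with h <;> simp [h]
  -- As N ≤ 2(|u| + |v| + 1), M ≤ 9N and E ≤ 6N, this b dominates the registers at every block
  -- boundary.
  let b := 200 * (u.length + v.length + 1)
  have hbdef : b = 200 * (u.length + v.length + 1) := rfl
  obtain ⟨hcT, hcTi, t₁, ht₁, x₁, hx₁, hreach₁⟩ := reaches_count u v (b := b) (by omega)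
  have hMN : M ≤ 9 * N := by
    rw [hMdef]
    split_ifs <;> omega
  have hEN : E ≤ 6 * N := by omega
  have hin : ∀ x ∈ lampPairCode u v, x ≤ b := fun x hx => (mem_lampPairCode hx).2.trans (by omega)
  obtain ⟨s, hs, hval, t₂, ht₂, x₂, hx₂, hw, hreach₂⟩ :=
    reaches_lamps u v (b := b) (M := M) (E := E) hM x₁ hx₁ (by omega)
  obtain ⟨t₃, ht₃, i, j, k, r, hk, hi, hj, hor, ⟨hinv, c, hc, rfl⟩, hreach₃⟩ :=
    reaches_compare u v (b := b) (E := E) hM hval.m_le (by omega)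
  have hmono : ∀ p ≤ 42, 2 ^ p * b ≤ 2 ^ 42 * b := fun p hp => by gcongr; norm_num
  have block₀ := (reaches_block (P := program) (K := 32) (b := b) (o := 0) (blk := initBlock)
    (input := lampPairCode u v) ⟨_, rfl⟩ (by simp [initBlock, Instr.Straight]) (by omega) hin
    (r := fun _ => 0) (by simp)).mono (hmono 8 (by norm_num))
  rw [eval_initBlock] at block₀
  have block₁ := (reaches_block (P := program) (K := 32) (b := b) (o := 28) (blk := lengthBlock)
    (input := lampPairCode u v) ⟨_, rfl⟩ (by simp [lengthBlock, Instr.Straight]) (by omega) hin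
    (r := countRegs N x₁ 1 (countT u) (countTInv u)
      (countT u + countT v) (countTInv u + countTInv v)) (by
        refine file_le ?_ (fun i => by omega)
        simp only [List.forall_mem_cons, List.not_mem_nil, IsEmpty.forall_iff,
          implies_true, and_true]
        omega)).mono (hmono 27 (by norm_num))
  rw [eval_lengthBlock, ← hMdef, ← hEdef] at block₁
  have block₂ := (reaches_block (P := program) (K := 32) (b := b) (o := 93) (blk := resetBlock)
    (input := lampPairCode u v) ⟨_, rfl⟩ (by simp [resetBlock, Instr.Straight]) (by omega) hin
    (r := lampRegs M E N x₂ s.w s.p s.m) (by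
        have := hval.p_lt
        refine file_le ?_ (fun i => (hval.m_le i).trans (by omega))
        simp only [List.forall_mem_cons, List.not_mem_nil, IsEmpty.forall_iff,
          implies_true, and_true]
        omega)).mono (hmono 4 (by norm_num))
  rw [eval_resetBlock] at block₂
  have block₃ := (reaches_block (P := program) (K := 32) (b := b) (o := 140) (blk := answerBlock)
    (input := lampPairCode u v) ⟨_, rfl⟩ (by simp [answerBlock, Instr.Straight]) (by omega) hin
    (r := compareRegs M E i j k c s.m) (by
        refine file_le ?_ (fun i => (hval.m_le i).trans (by omega))
        simp only [List.forall_mem_cons, List.not_mem_nil, IsEmpty.forall_iff,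
          implies_true, and_true]
        omega)).mono (hmono 3 (by norm_num))
  have total := (((((block₀.trans (hreach₁.mono (hmono 19 (by norm_num)))).trans block₁).trans
    (hreach₂.mono (hmono 37 (by norm_num)))).trans block₂).trans hreach₃).trans block₃
  have hanswer := eval_answerBlock (lampPairCode u v) M E i j k c s.m
  have hconj : IsConj (lampWordVal u) (lampWordVal v) ↔ E = 0 ∧ k = M := by
    rw [isConj_iff_cyclic (N := N) (by omega)
      (fun y hy => (lampWordVal_support u y hy).trans (by push_cast [hN]; omega))
      (fun y hy => (lampWordVal_support v y hy).trans (by push_cast [hN]; omega)), ← hδ, ← hE,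
      ← hMc]
    -- Rotations matter only when the positions agree, and then the residual rotation of the second
    -- array is trivial modulo M.
    refine and_congr_right fun hE0 => ?_
    obtain ⟨hA, hB⟩ := foldl_lamps_pair (v := v) hM hδM
    rw [← hs, ← hE.1 hE0, hδM] at *
    rw [exists_lampShift_iff_of_arrays hval.m_le hA (by simpa using hB)]
    have hmod : ∀ d x y : ℕ, x ≡ y [MOD M] →
        s.m (x % M + x % M + d) = s.m (y % M + y % M + d) := fun d x y hxy => by rw [hxy]
    constructor
    · intro h
      -- An exit with i or j at least M would exclude a rotation, so only k = M is left.
      rcases hor with h' | h' | h'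
      · exact absurd h (hinv.not_exists_shift_of_le_left hM (hmod 32) (hmod 33) h')
      · exact absurd h (hinv.not_exists_shift_of_le_right hM (hmod 32) (hmod 33) h')
      · omega
    · rintro rfl
      exact hinv.exists_shift hM (hmod 32) (hmod 33)
  -- The longest block has 42 instructions, and 200 < 2 ^ 18.
  have hB : 2 ^ 42 * b ≤ 2 ^ 60 * (u.length + v.length + 1) := by omega
  refine ⟨_, ?_, ?_, fun h => ?_, fun h => ?_, fun s hs i => (total.2 s hs i).trans hB⟩
  · simp only [initBlock, lengthBlock, resetBlock, answerBlock, List.length_cons, List.length_nil]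
    omega
  · rw [run, start, total.1]
    exact length_program.le
  · rw [run, start, total.1]
    rw [hconj] at h
    simp only [hanswer]
    omega
  · rw [run, start, total.1]
    rw [hconj] at h
    simp only [hanswer]
    omega

end LampMachine

theorem mainTheorem6 :
    -- the conjugacy problem is decided by a random-access machine in linear time
    (∃ (P : RAM.Program) (C : ℕ), ∀ u v : List LampLetter,
      RAM.DecidesWithin P (lampPairCode u v) (IsConj (lampWordVal u) (lampWordVal v))
        (C * (u.length + v.length + 1))) ∧
    -- conjugate elements have the same position
    (∀ c₁ c₂ : Lamplighter, IsConj c₁ c₂ → c₁.pos = c₂.pos) ∧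
    -- position zero: conjugacy is equality up to a shift
    (∀ c₁ c₂ : Lamplighter, c₁.pos = 0 → c₂.pos = 0 →
      (IsConj c₁ c₂ ↔ ∃ Δ : ℤ, c₁.lamps = lampShift c₂.lamps Δ)) ∧
    -- common nonzero position: conjugacy is cyclic rotation of the projections
    (∀ (δ : ℤ) (c₁ c₂ : Lamplighter), δ ≠ 0 → c₁.pos = δ → c₂.pos = δ →
      List.TFAE [
        IsConj c₁ c₂,
        ∃ Δ : ℤ, lampProj δ.natAbs c₁.lamps =
          lampShift (lampProj δ.natAbs c₂.lamps) (Δ : ZMod δ.natAbs),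
        List.IsRotated (lampBits δ.natAbs c₁.lamps) (lampBits δ.natAbs c₂.lamps),
        lampBits δ.natAbs c₁.lamps <:+:
          lampBits δ.natAbs c₂.lamps ++ lampBits δ.natAbs c₂.lamps]) :=
  ⟨⟨LampMachine.program, 2 ^ 60, LampMachine.decidesWithin_program⟩,
    fun c₁ c₂ h => ((lamplighter_isConj_iff c₁ c₂).1 h).1,
    fun _ _ h₁ h₂ => isConj_iff_of_pos_eq_zero h₁ h₂,
    fun _ _ _ hδ h₁ h₂ => lamplighter_conj_tfae hδ h₁ h₂⟩
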